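/- **Theorem 1.1 (Scale invariant Poisson spacings).** For $\theta>0$, a scale invariant Poisson point process (PPP) with rate $\theta$ is a Poisson point process on $(0,\infty)$ with intensity measure $\theta x^{-1}\,dx$. Fix $\theta>0$, and let $(T_z,\ z\in\mathbb Z)$ be random variables with $T_z<T_{z+1}$ for all $z\in\mathbb Z$, almost surely, that are an exhaustive listing of the points of a scale invariant PPP with rate $\theta$; that is, the point process $N_T(B):=\#\{z\in\mathbb Z: T_z\in B\}$ is a scale invariant PPP with rate $\theta$. Then the spacings $T_{z+1}-T_z$, $z\in\mathbb Z$, are almost surely pairwise distinct, and $$\{T_{z+1}-T_z : z\in\mathbb Z\}\ \stackrel{d}{=}\ \{T_z : z\in\mathbb Z\},$$ meaning that the point process $B\mapsto\#\{z\in\mathbb Z: T_{z+1}-T_z\in B\}$ has the same distribution as $N_T$. In other words, the spacings between consecutive points are again the points of a scale invariant PPP with rate $\theta$. -/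

import Mathlib

open MeasureTheory ProbabilityTheory Set Function
open scoped ENNReal NNReal

noncomputable section

namespace ScaleInvariantSpacings

/-- The Poisson distribution with mean `r ∈ [0, ∞]`, as a law on `[0, ∞]`. The mean `∞` corresponds
to the point mass at `∞`. -/
def poissonLaw (r : ℝ≥0∞) : Measure ℝ≥0∞ :=
  if r = ∞ then Measure.dirac ∞ else (poissonMeasure r.toNNReal).map (fun n : ℕ => (n : ℝ≥0∞))

/-- `N`, a random measure on `E` defined on the probability space `(Ω, P)`, is a Poisson point
process with intensity measure `μ`: the number of points in every measurable set `B` is Poisson with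
mean `μ B`, and the numbers of points in finitely many pairwise disjoint measurable sets are
independent. -/
structure IsPoissonPointProcess {Ω E : Type*} [MeasurableSpace Ω] [MeasurableSpace E]
    (N : Ω → Measure E) (μ : Measure E) (P : Measure Ω) : Prop where
  aemeasurable : AEMeasurable N P
  hasLaw : ∀ B : Set E, MeasurableSet B → HasLaw (fun ω => N ω B) (poissonLaw (μ B)) P
  indep : ∀ (n : ℕ) (B : Fin n → Set E), (∀ i, MeasurableSet (B i)) →
    Pairwise (Disjoint on B) → iIndepFun (fun i ω => N ω (B i)) P

/-- The point process `N_X(B) = #{z ∈ ℤ : X_z ∈ B}` of a sequence `X` of random points, as a random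
counting measure. -/
def pointProcess {Ω : Type*} (X : ℤ → Ω → ℝ) (ω : Ω) : Measure ℝ :=
  Measure.sum fun z : ℤ => Measure.dirac (X z ω)

/-- The random measure does count the indices `z` with `X_z ∈ B`. -/
theorem pointProcess_apply {Ω : Type*} (X : ℤ → Ω → ℝ) (ω : Ω) {B : Set ℝ}
    (hB : MeasurableSet B) :
    pointProcess X ω B = ({z : ℤ | X z ω ∈ B}.encard : ℝ≥0∞) := by
  rw [pointProcess, Measure.sum_apply _ hB, ← Measure.count_apply (MeasurableSet.of_discrete),
    Measure.count, Measure.sum_apply _ (MeasurableSet.of_discrete)]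
  refine tsum_congr fun z => ?_
  rw [Measure.dirac_apply' _ hB, Measure.dirac_apply' _ (MeasurableSet.of_discrete)]
  rfl

/-- The measure `θ x⁻¹ dx` on the half-line `(0, ∞)`, as a measure on `ℝ` that gives `(-∞, 0]` mass
zero (so that a Poisson point process with this intensity has no points there, almost surely). -/
def scaleInvariantIntensity (θ : ℝ) : Measure ℝ :=
  (volume.restrict (Ioi 0)).withDensity fun x => ENNReal.ofReal (θ / x)

/-- The points `X_z`, `z ∈ ℤ`, form a scale invariant Poisson point process on `(0, ∞)` of
rate `θ`. -/
def IsScaleInvariantPPP {Ω : Type*} [MeasurableSpace Ω] (X : ℤ → Ω → ℝ) (θ : ℝ)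
    (P : Measure Ω) : Prop :=
  IsPoissonPointProcess (pointProcess X) (scaleInvariantIntensity θ) P

/-- The spacings `T_{z+1} - T_z` of a sequence of random points. -/
def spacings {Ω : Type*} (T : ℤ → Ω → ℝ) : ℤ → Ω → ℝ := fun z ω => T (z + 1) ω - T z ω

end ScaleInvariantSpacings

end

open Filter
open scoped Topology BoundedContinuousFunction

noncomputable section

namespace ScaleInvariantSpacings

/-! ### The function `x ↦ exp (-x)` on `[0, ∞]` -/

/-! A Poisson process is recognised by its Laplace functional (`IsPoissonPointProcess.of_laplace`),
so the task is to compute `E exp (-∑ f (spacings))`. A.s. the points can be listed so that they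
accumulate exactly at `0` and `∞`, which gives meaning to the points before `t` in decreasing order.

The process has a renewal structure seen backwards: the last point before `t` has density `θ s ^ (θ
- 1) / t ^ θ` on `(0, t)`, and given that it is at `s`, the earlier points look like the points
before `s` (`pastLaw_eq_renewedLaw`). Conditioning on a point is avoided: both candidate joint laws
satisfy the same bounds on short intervals, with a gap of second order in logarithmic length, and
such bounds leave room for only one measure.

Put `g = exp (-f)`, and let `φ t` be the Laplace functional of the spacings among the points before
`t` and an extra point at `t`. The renewal structure gives `t ^ θ φ(t) = ∫₀ᵗ θ s ^ (θ - 1) φ(s) g(t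
- s) ds`. With `M(w) = ∫ e^(-ws) s ^ (θ - 1) φ(s) ds`, this convolution equation becomes `-M' = θ M
ĝ`, where `ĝ` is the Laplace transform of `g`. If `f` lives on `[a, b]` with `a > 0`, then `ĝ(w) =
1/w - ∫ e^(-wx) (1 - g(x)) dx`. Hence `w ^ θ M(w) e^(K(w))` is constant, where `K(w) = ∫ (θ/x) (1 -
g(x)) e^(-wx) dx`. At `w → ∞` its limit is `Γ(θ)`, as `φ(0+) = 1`; at `w → 0` it is `φ(∞) Γ(θ)
e^(K(0))`. So `φ(∞) = e^(-K(0))` (`limit_of_renewal`), which is the Poisson Laplace functional, and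
`φ(∞)` is the Laplace functional of all the spacings (`tendsto_pastLaplace`). Truncation removes the
support condition on `f`.

Equality in law follows since the intensity determines the law of a Poisson process
(`IsPoissonPointProcess.identDistrib`). Distinctness follows since a short interval contains two
points with probability of second order (`IsScaleInvariantPPP.ae_injective`). -/

/-- The function `x ↦ exp (-x)` on `[0, ∞]`, with `exp (-∞) = 0`. -/
def expNeg (x : ℝ≥0∞) : ℝ≥0∞ := EReal.exp (-(x : EReal))

@[simp] lemma expNeg_zero : expNeg 0 = 1 := by simp [expNeg]

@[simp] lemma expNeg_top : expNeg ∞ = 0 := by simp [expNeg]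

lemma continuous_expNeg : Continuous expNeg :=
  ENNReal.continuous_exp.comp (continuous_neg.comp continuous_coe_ennreal_ereal)

@[fun_prop]
lemma measurable_expNeg : Measurable expNeg := continuous_expNeg.measurable

lemma expNeg_add (x y : ℝ≥0∞) : expNeg (x + y) = expNeg x * expNeg y := by
  rw [expNeg, EReal.coe_ennreal_add, EReal.neg_add (by simp) (by simp), sub_eq_add_neg,
    EReal.exp_add, expNeg, expNeg]

lemma expNeg_antitone : Antitone expNeg := fun x y h => by
  simpa [expNeg] using h

lemma expNeg_le_one (x : ℝ≥0∞) : expNeg x ≤ 1 := by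
  simpa using expNeg_antitone (zero_le (a := x))

lemma expNeg_ne_top (x : ℝ≥0∞) : expNeg x ≠ ∞ := ne_top_of_le_ne_top (by simp) (expNeg_le_one x)

lemma expNeg_injective : Injective expNeg := fun x y h => by
  simpa [expNeg] using EReal.exp_strictMono.injective h

lemma expNeg_ofReal {x : ℝ} (hx : 0 ≤ x) :
    expNeg (ENNReal.ofReal x) = ENNReal.ofReal (Real.exp (-x)) := by
  rw [expNeg, EReal.coe_ennreal_ofReal, max_eq_left hx, ← EReal.coe_neg, EReal.exp_coe]

lemma expNeg_sum {ι : Type*} (s : Finset ι) (f : ι → ℝ≥0∞) :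
    expNeg (∑ i ∈ s, f i) = ∏ i ∈ s, expNeg (f i) := by
  classical
  induction s using Finset.induction_on with
  | empty => simp
  | insert i s hi ih => rw [Finset.sum_insert hi, Finset.prod_insert hi, expNeg_add, ih]

lemma expNeg_natCast_mul (k : ℕ) (x : ℝ≥0∞) : expNeg (k * x) = expNeg x ^ k := by
  induction k with
  | zero => simp
  | succ k ih => rw [Nat.cast_succ, add_mul, one_mul, expNeg_add, ih, pow_succ]

/-! ### Laplace transforms of measures on `[0, ∞]ⁿ` -/

/-- The function `x ↦ exp (-∑ kᵢ xᵢ)` on `[0, ∞]^ι`, as a bounded continuous function. -/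
def laplaceFun {ι : Type*} [Fintype ι] (k : ι → ℕ) : (ι → ℝ≥0∞) →ᵇ ℝ :=
  BoundedContinuousFunction.ofNormedAddCommGroup
    (fun x => (∏ i, expNeg (x i) ^ k i).toReal)
    (by
      simp_rw [ENNReal.toReal_prod, ENNReal.toReal_pow]
      refine continuous_finsetProd _ fun i _ => Continuous.pow ?_ _
      exact ENNReal.continuousOn_toReal.comp_continuous
        (continuous_expNeg.comp (continuous_apply i)) fun x => expNeg_ne_top _)
    1 fun x => by
      rw [Real.norm_of_nonneg ENNReal.toReal_nonneg]
      refine ENNReal.toReal_le_of_le_ofReal zero_le_one ?_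
      rw [ENNReal.ofReal_one]
      exact Finset.prod_le_one' fun i _ => pow_le_one' (expNeg_le_one _) _

lemma laplaceFun_apply {ι : Type*} [Fintype ι] (k : ι → ℕ) (x : ι → ℝ≥0∞) :
    laplaceFun k x = (∏ i, expNeg (x i) ^ k i).toReal := rfl

/-- A finite measure on `[0, ∞]^ι` is determined by its Laplace transform on `ℕ^ι`. -/
theorem ext_of_laplace {ι : Type*} [Fintype ι] {μ ν : Measure (ι → ℝ≥0∞)} [IsFiniteMeasure μ]
    [IsFiniteMeasure ν]
    (h : ∀ k : ι → ℕ, ∫⁻ x, expNeg (∑ i, k i * x i) ∂μ = ∫⁻ x, expNeg (∑ i, k i * x i) ∂ν) :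
    μ = ν := by
  classical
  -- Products of these exponentials are again such exponentials, so the algebra they generate is
  -- their linear span. It separates points because `expNeg` is injective on all of `[0, ∞]`.
  let S : Submonoid ((ι → ℝ≥0∞) →ᵇ ℝ) :=
    { carrier := range laplaceFun
      one_mem' := ⟨0, by ext x; simp [laplaceFun_apply]⟩
      mul_mem' := by
        rintro _ _ ⟨k, rfl⟩ ⟨l, rfl⟩
        refine ⟨k + l, ?_⟩
        ext x
        simp [laplaceFun_apply, pow_add, Finset.prod_mul_distrib] }
  let A : StarSubalgebra ℝ ((ι → ℝ≥0∞) →ᵇ ℝ) :=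
    { Algebra.adjoin ℝ (S : Set ((ι → ℝ≥0∞) →ᵇ ℝ)) with
      star_mem' := by
        intro a ha
        have : star a = a := by ext x; simp
        rwa [this] }
  refine ext_of_forall_mem_subalgebra_integral_eq_of_polish (𝕜 := ℝ) (A := A) ?_ ?_
  · intro x y hxy
    obtain ⟨i, hi⟩ := Function.ne_iff.1 hxy
    refine ⟨laplaceFun (Pi.single i 1), ⟨BoundedContinuousFunction.toContinuousMapStarₐ ℝ
      (laplaceFun (Pi.single i 1)), ⟨laplaceFun (Pi.single i 1), ?_, rfl⟩, rfl⟩, ?_⟩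
    · exact Algebra.subset_adjoin ⟨_, rfl⟩
    · have key : ∀ z : ι → ℝ≥0∞, laplaceFun (Pi.single i 1) z = (expNeg (z i)).toReal := by
        intro z
        rw [laplaceFun_apply, Finset.prod_eq_single i]
        · simp
        · intro j _ hj
          simp [hj]
        · simp
      rw [key, key]
      intro h
      exact hi (expNeg_injective ((ENNReal.toReal_eq_toReal_iff' (expNeg_ne_top _)
        (expNeg_ne_top _)).1 h))
  · intro g hgA
    have hg : g ∈ Submodule.span ℝ (S : Set ((ι → ℝ≥0∞) →ᵇ ℝ)) := by
      have : g ∈ Subalgebra.toSubmodule (Algebra.adjoin ℝ (S : Set ((ι → ℝ≥0∞) →ᵇ ℝ))) := hgA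
      rwa [Algebra.adjoin_eq_span, Submonoid.closure_eq] at this
    clear hgA
    induction hg using Submodule.span_induction with
    | mem g hg =>
      obtain ⟨k, rfl⟩ := hg
      have key : ∀ (ρ : Measure (ι → ℝ≥0∞)), ∫ x, laplaceFun k x ∂ρ =
          (∫⁻ x, expNeg (∑ i, k i * x i) ∂ρ).toReal := by
        intro ρ
        rw [← integral_toReal (Measurable.aemeasurable (by fun_prop))
          (ae_of_all _ fun x => (expNeg_ne_top _).lt_top)]
        refine integral_congr_ae (ae_of_all _ fun x => ?_)
        simp [laplaceFun_apply, expNeg_sum, expNeg_natCast_mul]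
      rw [key, key, h]
    | zero => simp
    | add f g _ _ hf hg =>
      simp only [BoundedContinuousFunction.coe_add, Pi.add_apply]
      rw [integral_add (f.integrable _) (g.integrable _),
        integral_add (f.integrable _) (g.integrable _), hf, hg]
    | smul c f _ hf =>
      simp only [BoundedContinuousFunction.coe_smul]
      rw [integral_smul, integral_smul, hf]

/-! ### Poisson laws -/

instance isProbabilityMeasure_poissonLaw (r : ℝ≥0∞) : IsProbabilityMeasure (poissonLaw r) := by
  unfold poissonLaw
  split_ifs
  · infer_instance
  · exact Measure.isProbabilityMeasure_map (by fun_prop)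

lemma poissonLaw_natCast {r : ℝ≥0∞} (hr : r ≠ ∞) (n : ℕ) :
    poissonLaw r {(n : ℝ≥0∞)} =
      ENNReal.ofReal (Real.exp (-r.toReal) * r.toReal ^ n / n.factorial) := by
  have : (fun m : ℕ => (m : ℝ≥0∞)) ⁻¹' {(n : ℝ≥0∞)} = {n} := by ext m; simp
  rw [poissonLaw, if_neg hr, Measure.map_apply (by fun_prop) (measurableSet_singleton _), this,
    poissonMeasure_singleton]
  rfl

lemma poissonLaw_zero {r : ℝ≥0∞} : poissonLaw r {0} = expNeg r := by
  by_cases hr : r = ∞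
  · simp [poissonLaw, hr]
  · have := poissonLaw_natCast hr 0
    simp only [Nat.cast_zero, pow_zero, mul_one, Nat.factorial_zero, Nat.cast_one, div_one] at this
    rw [this, ← expNeg_ofReal ENNReal.toReal_nonneg, ENNReal.ofReal_toReal hr]

/-- For finite mean this is the exponential series. For `r = ∞` both sides vanish unless `k = 0`,
where the convention `0 * ∞ = 0` gives `1` on both sides. -/
lemma lintegral_poissonLaw (r : ℝ≥0∞) (k : ℕ) :
    ∫⁻ x, expNeg (k * x) ∂poissonLaw r = expNeg ((1 - expNeg k) * r) := by
  by_cases hr : r = ∞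
  · rcases Nat.eq_zero_or_pos k with rfl | hk
    · simp
    · have h1 : 1 - expNeg k ≠ 0 := by
        rw [Ne, tsub_eq_zero_iff_le, not_le, expNeg]
        simpa using hk
      have h2 : (k : ℝ≥0∞) ≠ 0 := by simpa using hk.ne'
      rw [poissonLaw, if_pos hr, lintegral_dirac' _ (by fun_prop), hr, ENNReal.mul_top h1,
        ENNReal.mul_top h2]
  · lift r to ℝ≥0 using hr
    have hm : Measurable fun x : ℝ≥0∞ => expNeg (k * x) := by fun_prop
    rw [poissonLaw, if_neg (by simp), lintegral_map hm (by fun_prop), poissonMeasure]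
    simp only [lintegral_sum_measure, lintegral_smul_measure, lintegral_dirac, ENNReal.toNNReal_coe,
      smul_eq_mul]
    set q : ℝ := Real.exp (-k) with hq
    have hq1 : q ≤ 1 := by rw [hq, Real.exp_le_one_iff]; simp
    have hk : expNeg k = ENNReal.ofReal q := by
      rw [← ENNReal.ofReal_natCast, expNeg_ofReal (by positivity)]
    have hterm : ∀ n : ℕ, ENNReal.ofReal (Real.exp (-r) * r ^ n / n.factorial) *
        expNeg (k * n) = ENNReal.ofReal (Real.exp (-r) * ((r * q) ^ n / n.factorial)) := by
      intro n
      rw [mul_comm (k : ℝ≥0∞), expNeg_natCast_mul, hk, ← ENNReal.ofReal_pow (by positivity),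
        ← ENNReal.ofReal_mul (by positivity)]
      congr 1
      ring
    have hsum := (NormedSpace.expSeries_div_hasSum_exp ((r : ℝ) * q)).mul_left (Real.exp (-r))
    simp_rw [hterm]
    rw [← ENNReal.ofReal_tsum_of_nonneg (fun n => by positivity) hsum.summable, hsum.tsum_eq,
      ← Real.exp_eq_exp_ℝ, ← Real.exp_add, hk, ← ENNReal.ofReal_one,
      ← ENNReal.ofReal_sub _ (by positivity), ← ENNReal.ofReal_coe_nnreal,
      ← ENNReal.ofReal_mul (sub_nonneg.2 hq1),
      expNeg_ofReal (mul_nonneg (sub_nonneg.2 hq1) r.coe_nonneg)]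
    congr 2
    ring

lemma lintegral_pi_poissonLaw {ι : Type*} [Fintype ι] (r : ι → ℝ≥0∞) (k : ι → ℕ) :
    ∫⁻ x, expNeg (∑ i, k i * x i) ∂Measure.pi (fun i => poissonLaw (r i)) =
      expNeg (∑ i, (1 - expNeg (k i)) * r i) := by
  have hind : iIndepFun (fun i (x : ι → ℝ≥0∞) => expNeg (k i * x i))
      (Measure.pi fun i => poissonLaw (r i)) :=
    iIndepFun_pi (X := fun i y => expNeg (k i * y)) fun i => by fun_prop
  simp_rw [expNeg_sum]
  have := lintegral_prod_eq_prod_lintegral_of_indepFun Finset.univ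
    (fun i (x : ι → ℝ≥0∞) => expNeg (k i * x i)) hind (fun i => by fun_prop)
  rw [this]
  refine Finset.prod_congr rfl fun i _ => ?_
  rw [← lintegral_poissonLaw, ← (measurePreserving_eval (fun i => poissonLaw (r i)) i).map_eq,
    lintegral_map (by fun_prop) (measurable_pi_apply i)]

/-- A random measure with the Laplace functional of a Poisson point process is one. -/
theorem IsPoissonPointProcess.of_laplace {Ω E : Type*} [MeasurableSpace Ω] [MeasurableSpace E]
    {N : Ω → Measure E} {μ : Measure E} {P : Measure Ω} [IsProbabilityMeasure P]
    (hN : AEMeasurable N P)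
    (h : ∀ f : E → ℝ≥0∞, Measurable f →
      ∫⁻ ω, expNeg (∫⁻ x, f x ∂(N ω)) ∂P = expNeg (∫⁻ x, (1 - expNeg (f x)) ∂μ)) :
    IsPoissonPointProcess N μ P := by
  have hNB : ∀ B : Set E, MeasurableSet B → AEMeasurable (fun ω => N ω B) P := fun B hB =>
    (Measure.measurable_coe hB).comp_aemeasurable hN
  have key : ∀ (n : ℕ) (B : Fin n → Set E), (∀ i, MeasurableSet (B i)) →
      Pairwise (Disjoint on B) →
      P.map (fun ω i => N ω (B i)) = Measure.pi fun i => poissonLaw (μ (B i)) := by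
    intro n B hB hd
    have hae : AEMeasurable (fun ω (i : Fin n) => N ω (B i)) P :=
      aemeasurable_pi_lambda _ fun i => hNB _ (hB i)
    have := Measure.isProbabilityMeasure_map hae
    refine ext_of_laplace fun k => ?_
    rw [lintegral_pi_poissonLaw, lintegral_map'
      (Measurable.aemeasurable (by fun_prop)) hae]
    have hf := h (fun x => ∑ i, (B i).indicator (fun _ => (k i : ℝ≥0∞)) x)
      (Finset.measurable_fun_sum _ fun i _ => measurable_const.indicator (hB i))
    -- By disjointness at most one indicator is nonzero at `x`, so the nonlinear map `1 - expNeg`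
    -- passes through the sum.
    have h1 : ∀ x, 1 - expNeg (∑ i, (B i).indicator (fun _ => (k i : ℝ≥0∞)) x) =
        ∑ i, (B i).indicator (fun _ => 1 - expNeg (k i)) x := by
      intro x
      by_cases hx : ∃ i, x ∈ B i
      · obtain ⟨i, hi⟩ := hx
        have hj : ∀ j, j ≠ i → x ∉ B j := fun j hj hxj =>
          Set.disjoint_left.1 (hd hj) hxj hi
        rw [Finset.sum_eq_single i, Finset.sum_eq_single i, indicator_of_mem hi,
          indicator_of_mem hi]
        all_goals simp +contextual [hj]
      · push Not at hx
        simp [hx]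
    simp_rw [h1] at hf
    rw [lintegral_finsetSum _ fun i _ => measurable_const.indicator (hB i)] at hf
    simp_rw [lintegral_indicator_const (hB _)] at hf
    rw [← hf]
    refine lintegral_congr fun ω => ?_
    rw [lintegral_finsetSum _ fun i _ => measurable_const.indicator (hB i)]
    simp_rw [lintegral_indicator_const (hB _)]
  have hlaw : ∀ B : Set E, MeasurableSet B →
      HasLaw (fun ω => N ω B) (poissonLaw (μ B)) P := by
    intro B hB
    refine ⟨hNB B hB, ?_⟩
    have := key 1 (fun _ => B) (fun _ => hB) (Subsingleton.pairwise)
    have h2 := congrArg (Measure.map (Function.eval (0 : Fin 1))) this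
    rw [(measurePreserving_eval _ (0 : Fin 1)).map_eq,
      AEMeasurable.map_map_of_aemeasurable (measurable_pi_apply _).aemeasurable
        (aemeasurable_pi_lambda _ fun i => hNB _ hB)] at h2
    exact h2
  refine ⟨hN, hlaw, fun n B hB hd => ?_⟩
  rw [iIndepFun_iff_map_fun_eq_pi_map fun i => hNB _ (hB i), key n B hB hd]
  simp_rw [fun i => (hlaw _ (hB i)).map_eq]

/-! ### Finite-dimensional distributions of Poisson point processes -/

/-- The atoms of the algebra of sets generated by a finite family `B` of sets. -/
def atom {ι E : Type*} (B : ι → Set E) (s : Finset ι) : Set E := {x | ∀ i, i ∈ s ↔ x ∈ B i}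

lemma pairwise_disjoint_atom {ι E : Type*} (B : ι → Set E) : Pairwise (Disjoint on atom B) := by
  intro s t hst
  refine Set.disjoint_left.2 fun x hs ht => hst ?_
  ext i
  rw [hs i, ht i]

lemma measurableSet_atom {ι E : Type*} [Finite ι] [MeasurableSpace E] {B : ι → Set E}
    (hB : ∀ i, MeasurableSet (B i)) (s : Finset ι) : MeasurableSet (atom B s) := by
  rw [atom, ofPred_forall]
  refine MeasurableSet.iInter fun i => ?_
  by_cases hi : i ∈ s
  · simpa [hi] using hB i
  · simp only [hi, false_iff]
    exact (hB i).compl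

/-- Reduces counts on overlapping sets to counts on disjoint ones, the only sets for which the
definition of a Poisson process gives a joint law. -/
lemma measure_eq_sum_atom {ι E : Type*} [Fintype ι] [DecidableEq ι] [MeasurableSpace E]
    {B : ι → Set E} (hB : ∀ i, MeasurableSet (B i)) (ν : Measure E) (i : ι) :
    ν (B i) = ∑ s : Finset ι, if i ∈ s then ν (atom B s) else 0 := by
  have : B i = ⋃ s ∈ Finset.univ.filter fun s : Finset ι => i ∈ s, atom B s := by
    ext x
    simp only [mem_iUnion, Finset.mem_filter, Finset.mem_univ, true_and, exists_prop]
    constructor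
    · intro hx
      classical
      refine ⟨Finset.univ.filter fun j => x ∈ B j, by simpa using hx, fun j => by simp⟩
    · rintro ⟨s, his, hs⟩
      exact (hs i).1 his
  conv_lhs => rw [this]
  rw [measure_biUnion_finset (fun s _ t _ hst => pairwise_disjoint_atom B hst)
    fun s _ => measurableSet_atom hB s, Finset.sum_filter]

namespace IsPoissonPointProcess

variable {Ω E : Type*} [MeasurableSpace Ω] [MeasurableSpace E] {N : Ω → Measure E}
  {μ : Measure E} {P : Measure Ω}

lemma congr {N' : Ω → Measure E} (h : IsPoissonPointProcess N μ P) (hN : N =ᵐ[P] N') :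
    IsPoissonPointProcess N' μ P where
  aemeasurable := h.aemeasurable.congr hN
  hasLaw B hB := (h.hasLaw B hB).congr (hN.symm.fun_comp fun ν => ν B)
  indep n B hB hd := (h.indep n B hB hd).congr fun i => hN.fun_comp fun ν => ν (B i)

lemma aemeasurable_apply (h : IsPoissonPointProcess N μ P) {B : Set E} (hB : MeasurableSet B) :
    AEMeasurable (fun ω => N ω B) P := (h.hasLaw B hB).aemeasurable

lemma iIndepFun_apply (h : IsPoissonPointProcess N μ P) {κ : Type*} [Fintype κ] {C : κ → Set E}
    (hC : ∀ i, MeasurableSet (C i)) (hd : Pairwise (Disjoint on C)) :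
    iIndepFun (fun i ω => N ω (C i)) P := by
  let e := Fintype.equivFin κ
  have := (h.indep (Fintype.card κ) (C ∘ e.symm) (fun i => hC _)
    fun i j hij => hd (e.symm.injective.ne hij)).precomp e.injective
  simpa using this

/-- The finite-dimensional distributions of a Poisson point process are determined by its
intensity measure. -/
lemma map_apply_eq (h : IsPoissonPointProcess N μ P) {ι : Type*} [Fintype ι] [DecidableEq ι]
    {B : ι → Set E} (hB : ∀ i, MeasurableSet (B i)) :
    P.map (fun ω i => N ω (B i)) = (Measure.pi fun s => poissonLaw (μ (atom B s))).map
      fun y i => ∑ s : Finset ι, if i ∈ s then y s else 0 := by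
  have hl := (h.iIndepFun_apply (measurableSet_atom hB) (pairwise_disjoint_atom B)).hasLaw_pi
    fun s => h.hasLaw _ (measurableSet_atom hB s)
  have hm : Measurable fun (y : Finset ι → ℝ≥0∞) (i : ι) =>
      ∑ s : Finset ι, if i ∈ s then y s else 0 := by
    refine measurable_pi_lambda _ fun i => Finset.measurable_fun_sum _ fun s _ => ?_
    split_ifs
    · exact measurable_pi_apply s
    · exact measurable_const
  rw [← hl.map_eq, AEMeasurable.map_map_of_aemeasurable hm.aemeasurable hl.aemeasurable]
  congr 1
  ext ω i
  exact measure_eq_sum_atom hB _ i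

/-- The law of a Poisson point process is determined by its intensity measure. -/
theorem identDistrib {Ω' : Type*} [MeasurableSpace Ω'] {N' : Ω' → Measure E} {P' : Measure Ω'}
    [IsProbabilityMeasure P] [IsProbabilityMeasure P']
    (h : IsPoissonPointProcess N μ P) (h' : IsPoissonPointProcess N' μ P') :
    IdentDistrib N N' P P' := by
  refine ⟨h.aemeasurable, h'.aemeasurable, ?_⟩
  let e : Measure E → {B : Set E // MeasurableSet B} → ℝ≥0∞ := fun ν B => ν B
  have he : Measurable e := measurable_pi_lambda _ fun B => Measure.measurable_coe B.2
  -- The σ-algebra on measures is generated by the evaluations, so a law is determined by its image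
  -- in the product space, and there by its finite-dimensional marginals.
  have hcomap : (inferInstance : MeasurableSpace (Measure E)) =
      MeasurableSpace.comap e inferInstance := by
    refine le_antisymm ?_ he.comap_le
    refine iSup₂_le fun B hB => ?_
    rw [← measurable_iff_comap_le]
    exact (measurable_pi_apply (⟨B, hB⟩ : {B : Set E // MeasurableSet B})).comp
      (comap_measurable e)
  have hproj : (P.map N).map e = (P'.map N').map e := by
    rw [AEMeasurable.map_map_of_aemeasurable he.aemeasurable h.aemeasurable,
      AEMeasurable.map_map_of_aemeasurable he.aemeasurable h'.aemeasurable]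
    have h1 : AEMeasurable (e ∘ N) P := he.comp_aemeasurable h.aemeasurable
    have h2 : AEMeasurable (e ∘ N') P' := he.comp_aemeasurable h'.aemeasurable
    have := Measure.isProbabilityMeasure_map h1
    have := Measure.isProbabilityMeasure_map h2
    refine IsProjectiveLimit.unique
      (P := fun I : Finset {B : Set E // MeasurableSet B} => (P.map (e ∘ N)).map I.restrict)
      (fun I => rfl) fun I => ?_
    classical
    beta_reduce
    rw [AEMeasurable.map_map_of_aemeasurable (Finset.measurable_restrict I).aemeasurable h1,
      AEMeasurable.map_map_of_aemeasurable (Finset.measurable_restrict I).aemeasurable h2]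
    exact (h'.map_apply_eq (B := fun i : I => i.1.1) fun i => i.1.2).trans
      (h.map_apply_eq (B := fun i : I => i.1.1) fun i => i.1.2).symm
  ext A hA
  have hA' : MeasurableSet[MeasurableSpace.comap e inferInstance] A := hcomap ▸ hA
  obtain ⟨A', hA', rfl⟩ := hA'
  rw [← Measure.map_apply he hA', ← Measure.map_apply he hA', hproj]

/-- The numbers of points in subsets of `A` are independent of those in finitely many disjoint sets
that do not meet `A`. -/
theorem indepFun_process (h : IsPoissonPointProcess N μ P) [IsProbabilityMeasure P]
    {S κ : Type*} [Fintype κ] {A : Set E} (hA : MeasurableSet A) {B : S → Set E}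
    (hB : ∀ i, MeasurableSet (B i)) (hBA : ∀ i, B i ⊆ A) {C : κ → Set E}
    (hC : ∀ i, MeasurableSet (C i)) (hd : Pairwise (Disjoint on C))
    (hCA : ∀ i, Disjoint A (C i)) :
    IndepFun (fun ω i => N ω (B i)) (fun ω j => N ω (C j)) P := by
  classical
  refine IndepFun.process_indepFun₀ (fun i => h.aemeasurable_apply (hB i))
    (aemeasurable_pi_lambda _ fun j => h.aemeasurable_apply (hC j)) fun I => ?_
  -- The atom of the empty index set lies outside every `B i` and may meet the `C j`; intersecting
  -- with `A` keeps the family disjoint and does not change the atoms that matter.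
  let D : Finset I ⊕ κ → Set E := Sum.elim (fun s => atom (fun i : I => B i) s ∩ A) C
  have hat := measurableSet_atom (B := fun i : I => B i) fun i => hB i
  have hD : ∀ j, MeasurableSet (D j) := by
    rintro (s | j)
    · exact (hat s).inter hA
    · exact hC j
  have hDd : Pairwise (Disjoint on D) := by
    rintro (s | i) (t | j) hij
    · exact (pairwise_disjoint_atom _ fun hst : s = t => hij (hst ▸ rfl)).mono inter_subset_left
        inter_subset_left
    · exact (hCA j).mono_left inter_subset_right
    · exact (hCA i).symm.mono_right inter_subset_right
    · exact hd fun hst : i = j => hij (hst ▸ rfl)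
  have hind := (h.iIndepFun_apply hD hDd).indepFun_finset₀
    (Finset.univ.map Embedding.inl) (Finset.univ.map Embedding.inr)
    (by rw [Finset.disjoint_left]; simp) fun j => h.aemeasurable_apply (hD j)
  have hf : Measurable fun (y : ↥(Finset.univ.map Embedding.inl : Finset (Finset I ⊕ κ)) → ℝ≥0∞)
      (i : I) => ∑ s : Finset I, if i ∈ s then y ⟨Sum.inl s, by simp⟩ else 0 := by
    refine measurable_pi_lambda _ fun i => Finset.measurable_fun_sum _ fun s _ => ?_
    split_ifs
    · exact measurable_pi_apply _
    · exact measurable_const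
  have hg : Measurable fun (y : ↥(Finset.univ.map Embedding.inr : Finset (Finset I ⊕ κ)) → ℝ≥0∞)
      (j : κ) => y ⟨Sum.inr j, by simp⟩ := measurable_pi_lambda _ fun j => measurable_pi_apply _
  have := hind.comp hf hg
  refine this.congr (ae_of_all _ fun ω => ?_) (ae_of_all _ fun ω => rfl)
  ext i
  simp only [comp_apply]
  rw [measure_eq_sum_atom (B := fun i : I => B i) (fun i => hB i) (N ω) i]
  refine Finset.sum_congr rfl fun s _ => ?_
  split_ifs with his
  · change N ω (atom _ s ∩ A) = _
    rw [inter_eq_left.2]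
    intro x hx
    exact hBA i ((hx i).1 his)
  · rfl

end IsPoissonPointProcess

/-! ### The scale invariant intensity -/

lemma lintegral_scaleInvariantIntensity (θ : ℝ) {f : ℝ → ℝ≥0∞} (hf : Measurable f) :
    ∫⁻ x, f x ∂scaleInvariantIntensity θ = ∫⁻ x in Ioi 0, ENNReal.ofReal (θ / x) * f x := by
  rw [scaleInvariantIntensity, lintegral_withDensity_eq_lintegral_mul _ (by fun_prop) hf]
  rfl

lemma scaleInvariantIntensity_Iic (θ : ℝ) : scaleInvariantIntensity θ (Iic 0) = 0 := by
  rw [scaleInvariantIntensity]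
  refine withDensity_absolutelyContinuous _ _ ?_
  rw [Measure.restrict_apply measurableSet_Iic, Iic_inter_Ioi, Ioc_self, measure_empty]

lemma scaleInvariantIntensity_Ico {θ : ℝ} (hθ : 0 < θ) {r s : ℝ} (hr : 0 < r) (hrs : r ≤ s) :
    scaleInvariantIntensity θ (Ico r s) = ENNReal.ofReal (θ * (Real.log s - Real.log r)) := by
  have hs := hr.trans_le hrs
  rw [scaleInvariantIntensity, withDensity_apply _ measurableSet_Ico,
    Measure.restrict_restrict measurableSet_Ico,
    inter_eq_left.2 fun x (hx : x ∈ Ico r s) => mem_Ioi.2 (hr.trans_le hx.1),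
    setLIntegral_congr Ico_ae_eq_Ioc, ← ofReal_integral_eq_lintegral_ofReal,
    ← intervalIntegral.integral_of_le hrs]
  · simp_rw [div_eq_mul_inv]
    rw [intervalIntegral.integral_const_mul, integral_inv_of_pos hr hs,
      Real.log_div hs.ne' hr.ne']
  · refine IntegrableOn.mono_set ?_ Ioc_subset_Icc_self
    refine ContinuousOn.integrableOn_compact isCompact_Icc ?_
    exact continuousOn_const.div continuousOn_id fun x hx => (hr.trans_le hx.1).ne'
  · filter_upwards [ae_restrict_mem measurableSet_Ioc] with x hx
    exact div_nonneg hθ.le (hr.trans hx.1).le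

lemma eq_top_of_forall_nat_mul_le {a : ℝ≥0∞} {c : ℝ} (hc : 0 < c)
    (h : ∀ n : ℕ, ENNReal.ofReal (c * n) ≤ a) : a = ∞ := by
  refine ENNReal.eq_top_of_forall_nnreal_le fun r => ?_
  obtain ⟨n, hn⟩ := exists_nat_ge (r / c)
  refine le_trans ?_ (h n)
  rw [← ENNReal.ofReal_coe_nnreal]
  exact ENNReal.ofReal_le_ofReal (by rwa [div_le_iff₀' hc] at hn)

lemma scaleInvariantIntensity_Ioo_eq_top {θ : ℝ} (hθ : 0 < θ) {ε : ℝ} (hε : 0 < ε) :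
    scaleInvariantIntensity θ (Ioo 0 ε) = ∞ := by
  refine eq_top_of_forall_nat_mul_le hθ fun n => ?_
  -- The interval from `ε e^(-n)` to `ε` has logarithmic length `n`, hence mass `θ n`.
  have hpos : 0 < ε * Real.exp (-n) := by positivity
  have hle : ε * Real.exp (-n) ≤ ε :=
    mul_le_of_le_one_right hε.le (Real.exp_le_one_iff.2 (by simp))
  have h := scaleInvariantIntensity_Ico hθ hpos hle
  rw [Real.log_mul hε.ne' (Real.exp_pos _).ne', Real.log_exp] at h
  rw [show θ * n = θ * (Real.log ε - (Real.log ε + -n)) by ring, ← h]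
  exact measure_mono fun x hx => ⟨hpos.trans_le hx.1, hx.2⟩

lemma scaleInvariantIntensity_Ioi_eq_top {θ : ℝ} (hθ : 0 < θ) (K : ℝ) :
    scaleInvariantIntensity θ (Ioi K) = ∞ := by
  refine eq_top_of_forall_nat_mul_le hθ fun n => ?_
  have hK : 0 < |K| + 1 := by positivity
  have hle : |K| + 1 ≤ (|K| + 1) * Real.exp n :=
    le_mul_of_one_le_right hK.le (Real.one_le_exp (by simp))
  have h := scaleInvariantIntensity_Ico hθ hK hle
  rw [Real.log_mul hK.ne' (Real.exp_pos _).ne', Real.log_exp] at h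
  rw [show θ * n = θ * (Real.log (|K| + 1) + n - Real.log (|K| + 1)) by ring, ← h]
  exact measure_mono fun x hx => lt_of_lt_of_le (by linarith [le_abs_self K]) hx.1

/-! ### Void probabilities -/

lemma IsPoissonPointProcess.measure_apply_eq_zero {Ω E : Type*} [MeasurableSpace Ω]
    [MeasurableSpace E] {N : Ω → Measure E} {μ : Measure E} {P : Measure Ω}
    (h : IsPoissonPointProcess N μ P) {B : Set E} (hB : MeasurableSet B) :
    P {ω | N ω B = 0} = expNeg (μ B) := by
  rw [← poissonLaw_zero, ← (h.hasLaw B hB).map_eq,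
    Measure.map_apply_of_aemeasurable (h.aemeasurable_apply hB) (measurableSet_singleton _)]
  rfl

lemma IsPoissonPointProcess.measure_apply_eq_one {Ω E : Type*} [MeasurableSpace Ω]
    [MeasurableSpace E] {N : Ω → Measure E} {μ : Measure E} {P : Measure Ω}
    (h : IsPoissonPointProcess N μ P) {B : Set E} (hB : MeasurableSet B) (hμ : μ B ≠ ∞) :
    P {ω | N ω B = 1} = ENNReal.ofReal (Real.exp (-(μ B).toReal) * (μ B).toReal) := by
  have := poissonLaw_natCast hμ 1
  simp only [Nat.cast_one, pow_one, Nat.factorial_one, div_one] at this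
  rw [← this, ← (h.hasLaw B hB).map_eq,
    Measure.map_apply_of_aemeasurable (h.aemeasurable_apply hB) (measurableSet_singleton _)]
  rfl

/-! ### Reduction to listings that are regular everywhere -/

lemma pointProcess_eq_zero_iff {Ω : Type*} {X : ℤ → Ω → ℝ} {ω : Ω} {B : Set ℝ}
    (hB : MeasurableSet B) : pointProcess X ω B = 0 ↔ ∀ z, X z ω ∉ B := by
  rw [pointProcess_apply X ω hB]
  simp [eq_empty_iff_forall_notMem]

/-- A measurable, strictly increasing listing of positive points that accumulate exactly at `0` and
at `∞`. -/
structure IsRegularListing {Ω : Type*} [MeasurableSpace Ω] (T : ℤ → Ω → ℝ) : Prop where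
  measurable : ∀ z, Measurable (T z)
  strictMono : ∀ ω, StrictMono fun z => T z ω
  pos : ∀ z ω, 0 < T z ω
  exists_lt : ∀ ω, ∀ ε > 0, ∃ z, T z ω < ε
  exists_gt : ∀ ω K, ∃ z, K < T z ω

/-- The intensity is zero on `(-∞, 0]` and infinite near `0` and near `∞`, so positivity and
accumulation at both ends hold a.s. On a measurable null set containing the exceptions, the listing
is replaced by `z ↦ e^z`, so that later arguments need no exceptional set. -/
lemma exists_isRegularListing {Ω : Type*} [MeasurableSpace Ω] {P : Measure Ω} {θ : ℝ}
    (hθ : 0 < θ) {T : ℤ → Ω → ℝ} (hT : ∀ z, AEMeasurable (T z) P)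
    (hmono : ∀ᵐ ω ∂P, ∀ z, T z ω < T (z + 1) ω) (hPPP : IsScaleInvariantPPP T θ P) :
    ∃ T' : ℤ → Ω → ℝ, IsRegularListing T' ∧ ∀ᵐ ω ∂P, ∀ z, T z ω = T' z ω := by
  classical
  have hpos : ∀ᵐ ω ∂P, ∀ z, 0 < T z ω := by
    have hl := hPPP.hasLaw (Iic 0) measurableSet_Iic
    rw [scaleInvariantIntensity_Iic, poissonLaw, if_neg (by simp)] at hl
    have h0 : P.map (fun ω => pointProcess T ω (Iic 0)) {0}ᶜ = 0 := by
      rw [hl.map_eq, Measure.map_apply (by fun_prop) (measurableSet_singleton _).compl]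
      have h1 : (fun n : ℕ => (n : ℝ≥0∞)) ⁻¹' {0}ᶜ = {0}ᶜ := by ext; simp
      rw [h1, prob_compl_eq_zero_iff (measurableSet_singleton _), poissonMeasure_singleton]
      simp
    rw [Measure.map_apply_of_aemeasurable hl.aemeasurable
      (measurableSet_singleton _).compl] at h0
    have h2 : ∀ᵐ ω ∂P, pointProcess T ω (Iic 0) = 0 := h0
    filter_upwards [h2] with ω hω z
    rw [pointProcess_eq_zero_iff measurableSet_Iic] at hω
    simpa using hω z
  have hex : ∀ B : Set ℝ, MeasurableSet B → scaleInvariantIntensity θ B = ∞ →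
      ∀ᵐ ω ∂P, ∃ z, T z ω ∈ B := by
    intro B hB hμ
    have hl := hPPP.hasLaw B hB
    rw [hμ, poissonLaw, if_pos rfl] at hl
    filter_upwards [hl.ae_eq_of_dirac] with ω hω
    by_contra! hne
    rw [← pointProcess_eq_zero_iff hB, hω] at hne
    exact ENNReal.top_ne_zero hne
  have hlow : ∀ᵐ ω ∂P, ∀ n : ℕ, ∃ z, T z ω ∈ Ioo (0 : ℝ) (1 / (n + 1)) :=
    ae_all_iff.2 fun n => hex _ measurableSet_Ioo
      (scaleInvariantIntensity_Ioo_eq_top hθ (by positivity))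
  have hhigh : ∀ᵐ ω ∂P, ∀ n : ℕ, ∃ z, T z ω ∈ Ioi (n : ℝ) :=
    ae_all_iff.2 fun n => hex _ measurableSet_Ioi (scaleInvariantIntensity_Ioi_eq_top hθ _)
  have hmk : ∀ᵐ ω ∂P, ∀ z, T z ω = (hT z).mk (T z) ω := ae_all_iff.2 fun z => (hT z).ae_eq_mk
  have hgood : ∀ᵐ ω ∂P, (∀ z, T z ω = (hT z).mk (T z) ω) ∧ (StrictMono fun z => T z ω) ∧
      (∀ z, 0 < T z ω) ∧ (∀ ε > 0, ∃ z, T z ω < ε) ∧ ∀ K, ∃ z, K < T z ω := by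
    filter_upwards [hpos, hlow, hhigh, hmk, hmono] with ω h1 h2 h3 h4 h5
    refine ⟨h4, strictMono_int_of_lt_succ h5, h1, fun ε hε => ?_, fun K => ?_⟩
    · obtain ⟨n, hn⟩ := exists_nat_one_div_lt hε
      obtain ⟨z, hz⟩ := h2 n
      exact ⟨z, hz.2.trans hn⟩
    · obtain ⟨n, hn⟩ := exists_nat_ge K
      obtain ⟨z, hz⟩ := h3 n
      exact ⟨z, hn.trans_lt hz⟩
  obtain ⟨S, hSsub, hSm, hS⟩ := exists_measurable_superset_of_null hgood
  have hin : ∀ ω, ω ∉ S → _ := fun ω hω => not_not.1 fun h => hω (hSsub h)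
  have hexp0 : ∀ ε : ℝ, 0 < ε → ∃ z : ℤ, Real.exp z < ε := fun ε hε => by
    obtain ⟨z, hz⟩ := exists_int_lt (Real.log ε)
    exact ⟨z, (Real.lt_log_iff_exp_lt hε).1 hz⟩
  have hexp1 : ∀ K : ℝ, ∃ z : ℤ, K < Real.exp z := fun K => by
    obtain ⟨z, hz⟩ := exists_int_gt K
    exact ⟨z, hz.trans_le ((by linarith : (z : ℝ) ≤ z + 1).trans (Real.add_one_le_exp _))⟩
  have hS' : ∀ᵐ ω ∂P, ω ∉ S := measure_eq_zero_iff_ae_notMem.1 hS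
  refine ⟨fun z ω => if ω ∈ S then Real.exp z else (hT z).mk (T z) ω, ⟨fun z => ?_, fun ω => ?_,
    fun z ω => ?_, fun ω ε hε => ?_, fun ω K => ?_⟩, ?_⟩
  · exact Measurable.ite hSm measurable_const (hT z).measurable_mk
  · by_cases hω : ω ∈ S
    · simp only [hω, if_true]
      exact Real.exp_strictMono.comp Int.cast_strictMono
    · simp only [hω, if_false, ← (hin ω hω).1]
      exact (hin ω hω).2.1
  · split_ifs with hω
    · positivity
    · rw [← (hin ω hω).1]
      exact (hin ω hω).2.2.1 z
  · by_cases hω : ω ∈ S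
    · simpa only [hω, if_true] using hexp0 ε hε
    · simpa only [hω, if_false, ← (hin ω hω).1] using (hin ω hω).2.2.2.1 ε hε
  · by_cases hω : ω ∈ S
    · simpa only [hω, if_true] using hexp1 K
    · simpa only [hω, if_false, ← (hin ω hω).1] using (hin ω hω).2.2.2.2 K
  · filter_upwards [hS'] with ω hω z
    rw [if_neg hω]
    exact (hin ω hω).1 z

/-! ### The points before a fixed position -/

/-- Used to carry independence from counts to the past: the order statistics are functions of the
counts. -/
lemma comap_le_comap_of_forall_lt {Ω α : Type*} [mα : MeasurableSpace α] {X : Ω → ℕ → ℝ}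
    {Y : Ω → α} (h : ∀ k q, ∃ A, MeasurableSet A ∧ ∀ ω, X ω k < q ↔ Y ω ∈ A) :
    MeasurableSpace.comap X inferInstance ≤ MeasurableSpace.comap Y mα := by
  let : MeasurableSpace Ω := MeasurableSpace.comap Y mα
  rw [← measurable_iff_comap_le]
  refine measurable_pi_iff.2 fun k => measurable_of_Iio fun q => ?_
  obtain ⟨A, hA, hXA⟩ := h k q
  refine ⟨A, hA, ?_⟩
  ext ω
  exact (hXA ω).symm

section Past

variable {Ω : Type*} {T : ℤ → Ω → ℝ}

/-- The index of the last point before `s`. -/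
def lastIndex (T : ℤ → Ω → ℝ) (s : ℝ) (ω : Ω) : ℤ := sSup {z | T z ω < s}

/-- The points before `s`, in decreasing order. -/
def past (T : ℤ → Ω → ℝ) (s : ℝ) (ω : Ω) : ℕ → ℝ := fun k => T (lastIndex T s ω - k) ω

variable [MeasurableSpace Ω]

lemma IsRegularListing.lt_iff (h : IsRegularListing T) {s : ℝ} (hs : 0 < s) (ω : Ω) (z : ℤ) :
    T z ω < s ↔ z ≤ lastIndex T s ω := by
  have hne : {z | T z ω < s}.Nonempty := h.exists_lt ω s hs
  have hbdd : BddAbove {z | T z ω < s} := by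
    obtain ⟨w, hw⟩ := h.exists_gt ω s
    refine ⟨w, fun z hz => ?_⟩
    exact ((h.strictMono ω).lt_iff_lt.1 (lt_trans hz hw)).le
  refine ⟨fun hz => le_csSup hbdd hz, fun hz => ?_⟩
  exact ((h.strictMono ω).monotone hz).trans_lt (Int.csSup_mem hne hbdd)

lemma IsRegularListing.lastIndex_eq (h : IsRegularListing T) {s : ℝ} (hs : 0 < s) {ω : Ω} {w : ℤ}
    (hw : ∀ z, T z ω < s ↔ z ≤ w) : lastIndex T s ω = w := by
  refine le_antisymm ?_ ?_
  · rw [← hw, h.lt_iff hs]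
  · rw [← h.lt_iff hs, hw]

lemma IsRegularListing.past_lt (h : IsRegularListing T) {s : ℝ} (hs : 0 < s) (ω : Ω) (k : ℕ) :
    past T s ω k < s := by
  rw [past, h.lt_iff hs]
  omega

lemma IsRegularListing.past_pos (h : IsRegularListing T) (s : ℝ) (ω : Ω) (k : ℕ) :
    0 < past T s ω k := h.pos _ _

lemma IsRegularListing.measurable_lastIndex (h : IsRegularListing T) :
    Measurable fun p : ℝ × Ω => lastIndex T p.1 p.2 := by
  refine measurable_of_Ici fun z => ?_
  -- For `s ≤ 0` no point lies before `s`, and the index takes the default value `sSup ∅`.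
  have : (fun p : ℝ × Ω => lastIndex T p.1 p.2) ⁻¹' Ici z =
      ({p | 0 < p.1} ∩ {p | T z p.2 < p.1}) ∪ ({p | p.1 ≤ 0} ∩ {_p | z ≤ sSup ∅}) := by
    ext ⟨s, ω⟩
    simp only [mem_preimage, mem_Ici, mem_union, mem_inter_iff, mem_ofPred_eq]
    rcases lt_or_ge 0 s with hs | hs
    · simp [hs, hs.not_ge, h.lt_iff hs]
    · have : {z | T z ω < s} = ∅ :=
        eq_empty_of_forall_notMem fun z hz => (hs.trans_lt (h.pos z ω)).not_gt hz
      simp [hs, hs.not_gt, lastIndex, this]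
  rw [this]
  refine MeasurableSet.union (MeasurableSet.inter ?_ ?_) (MeasurableSet.inter ?_ ?_)
  · exact measurableSet_lt measurable_const measurable_fst
  · exact measurableSet_lt ((h.measurable z).comp measurable_snd) measurable_fst
  · exact measurableSet_le measurable_fst measurable_const
  · exact MeasurableSet.const _

lemma IsRegularListing.measurable_past (h : IsRegularListing T) :
    Measurable fun p : ℝ × Ω => past T p.1 p.2 := by
  refine measurable_pi_lambda _ fun k => ?_
  have hT : Measurable fun q : ℤ × Ω => T q.1 q.2 :=
    measurable_from_prod_countable_right fun z => h.measurable z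
  have hZ : Measurable fun p : ℝ × Ω => (lastIndex T p.1 p.2 - k, p.2) :=
    ((measurable_from_top (f := fun z : ℤ => z - k)).comp h.measurable_lastIndex).prodMk
      measurable_snd
  exact hT.comp hZ

lemma IsRegularListing.measurable_past_apply (h : IsRegularListing T) (s : ℝ) :
    Measurable (past T s) :=
  h.measurable_past.comp measurable_prodMk_left

/-- Counting from `k = 0`, the entry `k` is at least `q` exactly when the `k + 1` last points before
`s` all lie in `[q, s)`. -/
lemma IsRegularListing.past_lt_iff (h : IsRegularListing T) {s : ℝ} (hs : 0 < s) (ω : Ω) (k : ℕ)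
    (q : ℝ) : past T s ω k < q ↔ pointProcess T ω (Ico q s) ≤ k := by
  rw [pointProcess_apply T ω measurableSet_Ico, ← ENat.toENNReal_coe, ENat.toENNReal_le]
  constructor
  · intro hq
    have hsub : {z | T z ω ∈ Ico q s} ⊆
        (Finset.Ioc (lastIndex T s ω - k) (lastIndex T s ω) : Finset ℤ) := by
      intro z hz
      rw [Finset.coe_Ioc]
      refine ⟨(h.strictMono ω).lt_iff_lt.1 (hq.trans_le hz.1), ?_⟩
      exact (h.lt_iff hs ω z).1 hz.2
    refine (encard_le_encard hsub).trans ?_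
    rw [encard_coe_eq_coe_finsetCard]
    simp
  · intro hle
    by_contra! hq
    have hsub : ((Finset.Icc (lastIndex T s ω - k) (lastIndex T s ω) : Finset ℤ) : Set ℤ) ⊆
        {z | T z ω ∈ Ico q s} := by
      intro z hz
      rw [Finset.coe_Icc] at hz
      exact ⟨hq.trans ((h.strictMono ω).monotone hz.1), (h.lt_iff hs ω z).2 hz.2⟩
    have := (encard_le_encard hsub).trans hle
    rw [encard_coe_eq_coe_finsetCard, Nat.cast_le] at this
    simp only [Int.card_Icc] at this
    omega

lemma IsRegularListing.past_eq_of_eq_zero (h : IsRegularListing T) {r s : ℝ} (hr : 0 < r)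
    (hrs : r ≤ s) {ω : Ω} (h0 : pointProcess T ω (Ico r s) = 0) : past T s ω = past T r ω := by
  rw [pointProcess_eq_zero_iff measurableSet_Ico] at h0
  have : lastIndex T s ω = lastIndex T r ω := by
    refine h.lastIndex_eq (hr.trans_le hrs) fun z => ?_
    rw [← h.lt_iff hr]
    refine ⟨fun hz => ?_, fun hz => hz.trans_le hrs⟩
    by_contra! hz'
    exact h0 z ⟨hz', hz⟩
  ext k
  rw [past, past, this]

lemma IsRegularListing.past_of_eq_one (h : IsRegularListing T) {r s : ℝ} (hr : 0 < r)
    (hrs : r ≤ s) {ω : Ω} (h1 : pointProcess T ω (Ico r s) = 1) :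
    past T s ω 0 ∈ Ico r s ∧ (fun k => past T s ω (k + 1)) = past T r ω := by
  have hs := hr.trans_le hrs
  rw [pointProcess_apply T ω measurableSet_Ico, ← ENat.toENNReal_one, ENat.toENNReal_inj,
    encard_eq_one] at h1
  obtain ⟨z₀, hz₀⟩ := h1
  have hmem : ∀ z, T z ω ∈ Ico r s ↔ z = z₀ := fun z => by
    rw [← mem_singleton_iff, ← hz₀, mem_ofPred_eq]
  have hmono := h.strictMono ω
  have hz : T z₀ ω ∈ Ico r s := (hmem z₀).2 rfl
  have hZs : lastIndex T s ω = z₀ := by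
    refine h.lastIndex_eq hs fun z => ⟨fun hlt => ?_, fun hle => ?_⟩
    · by_contra! hgt
      exact hgt.ne' ((hmem z).1 ⟨hz.1.trans (hmono hgt).le, hlt⟩)
    · exact (hmono.monotone hle).trans_lt hz.2
  have hZr : lastIndex T r ω = z₀ - 1 := by
    refine h.lastIndex_eq hr fun z => ⟨fun hlt => ?_, fun hle => ?_⟩
    · have := hmono.lt_iff_lt.1 (hlt.trans_le hz.1)
      omega
    · by_contra! hge
      have hlt : z < z₀ := by omega
      exact hlt.ne ((hmem z).1 ⟨hge, (hmono hlt).trans hz.2⟩)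
  constructor
  · simpa [past, hZs] using hz
  · ext k
    rw [past, past, hZs, hZr]
    congr 1
    push_cast
    ring

/-- The points before `r` are independent of the numbers of points in sets after `r`. -/
lemma IsRegularListing.indepFun_past (h : IsRegularListing T) {P : Measure Ω}
    [IsProbabilityMeasure P] {θ : ℝ} (hPPP : IsScaleInvariantPPP T θ P) {r : ℝ} (hr : 0 < r)
    {κ : Type*} [Fintype κ] {C : κ → Set ℝ} (hC : ∀ i, MeasurableSet (C i))
    (hd : Pairwise (Disjoint on C)) (hCr : ∀ i, C i ⊆ Ici r) :
    IndepFun (past T r) (fun ω j => pointProcess T ω (C j)) P := by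
  have hind := hPPP.indepFun_process (S := ℝ) measurableSet_Iio (B := fun q => Ico q r)
    (fun q => measurableSet_Ico) (fun q x hx => hx.2) hC hd fun i =>
      Set.disjoint_left.2 fun x (hx : x < r) hxC => (mem_Ici.1 (hCr i hxC)).not_gt hx
  rw [IndepFun_iff_Indep] at hind ⊢
  refine indep_of_indep_of_le_left hind ?_
  refine comap_le_comap_of_forall_lt fun k q => ⟨{y | y q ≤ k}, ?_, fun ω => ?_⟩
  · exact measurableSet_le (measurable_pi_apply q) measurable_const
  · exact h.past_lt_iff hr ω k q

end Past

/-- A quadratic modulus of continuity forces the derivative to vanish. This turns second-order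
estimates on short intervals into exact identities, both for the uniqueness of the renewal law and
for the distinctness of points. -/
lemma eq_of_abs_sub_le_mul_sq {F : ℝ → ℝ} {C : ℝ}
    (h : ∀ u v, u ≤ v → |F v - F u| ≤ C * (v - u) ^ 2) (u v : ℝ) : F u = F v := by
  have h' : ∀ x y, |F y - F x| ≤ C * (y - x) ^ 2 := by
    intro x y
    rcases le_total x y with hxy | hxy
    · exact h x y hxy
    · rw [abs_sub_comm, show (y - x) ^ 2 = (x - y) ^ 2 by ring]
      exact h y x hxy
  have hderiv : ∀ x, HasDerivAt F 0 x := by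
    intro x
    rw [hasDerivAt_iff_isLittleO]
    have hO : (fun y => F y - F x - (y - x) • (0 : ℝ)) =O[𝓝 x] fun y => (y - x) ^ 2 := by
      refine Asymptotics.IsBigO.of_bound C (Eventually.of_forall fun y => ?_)
      simpa using h' x y
    refine hO.trans_isLittleO ?_
    have : Tendsto (fun y : ℝ => y - x) (𝓝 x) (𝓝 0) := by
      simpa using (continuous_sub_right x).tendsto x
    have h2 : (fun y : ℝ => y ^ 2) =o[𝓝 0] fun y => y := by
      simpa using Asymptotics.isLittleO_pow_id (𝕜 := ℝ) (n := 2) (by norm_num)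
    exact h2.comp_tendsto this
  exact is_const_of_deriv_eq_zero (fun x => (hderiv x).differentiableAt)
    (fun x => (hderiv x).deriv) u v

/-! ### The renewal property of the points before a fixed position -/

section Renewal

variable {Ω : Type*} [MeasurableSpace Ω] {T : ℤ → Ω → ℝ} {P : Measure Ω} {θ : ℝ}

lemma expNeg_scaleInvariantIntensity_Ico (hθ : 0 < θ) {r s : ℝ} (hr : 0 < r) (hrs : r ≤ s) :
    expNeg (scaleInvariantIntensity θ (Ico r s)) = ENNReal.ofReal ((r / s) ^ θ) := by
  have hs := hr.trans_le hrs
  rw [scaleInvariantIntensity_Ico hθ hr hrs, expNeg_ofReal (mul_nonneg hθ.le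
    (sub_nonneg.2 (Real.log_le_log hr hrs))), Real.rpow_def_of_pos (by positivity),
    Real.log_div hr.ne' hs.ne']
  congr 2
  ring

lemma IsScaleInvariantPPP.measure_Ico_eq_zero (hθ : 0 < θ) (h : IsScaleInvariantPPP T θ P)
    {r s : ℝ} (hr : 0 < r) (hrs : r ≤ s) :
    P {ω | pointProcess T ω (Ico r s) = 0} = ENNReal.ofReal ((r / s) ^ θ) := by
  rw [IsPoissonPointProcess.measure_apply_eq_zero h measurableSet_Ico,
    expNeg_scaleInvariantIntensity_Ico hθ hr hrs]

lemma IsScaleInvariantPPP.measure_Ico_eq_one (hθ : 0 < θ) (h : IsScaleInvariantPPP T θ P)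
    {r s : ℝ} (hr : 0 < r) (hrs : r ≤ s) :
    P {ω | pointProcess T ω (Ico r s) = 1} =
      ENNReal.ofReal ((r / s) ^ θ * (θ * (Real.log s - Real.log r))) := by
  have hs := hr.trans_le hrs
  have h0 : 0 ≤ θ * (Real.log s - Real.log r) :=
    mul_nonneg hθ.le (sub_nonneg.2 (Real.log_le_log hr hrs))
  rw [IsPoissonPointProcess.measure_apply_eq_one h measurableSet_Ico
    (by rw [scaleInvariantIntensity_Ico hθ hr hrs]; simp),
    scaleInvariantIntensity_Ico hθ hr hrs, ENNReal.toReal_ofReal h0,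
    Real.rpow_def_of_pos (by positivity), Real.log_div hr.ne' hs.ne']
  congr 3
  ring

/-- Bounds that characterize the joint law of the last point before `t` and of the sequence of
points before it. -/
structure IsRenewalLaw (T : ℤ → Ω → ℝ) (θ : ℝ) (P : Measure Ω) (t : ℝ)
    (Q : Measure (ℝ × (ℕ → ℝ))) : Prop where
  isFiniteMeasure : IsFiniteMeasure Q
  compl_eq_zero : Q ((Ioo 0 t)ᶜ ×ˢ univ) = 0
  le_Ico : ∀ r s, 0 < r → r ≤ s → s ≤ t → ∀ B, MeasurableSet B →
    (r / t) ^ θ * (θ * (Real.log s - Real.log r)) * P.real (past T r ⁻¹' B) ≤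
      Q.real (Ico r s ×ˢ B)
  Ico_univ_le : ∀ r s, 0 < r → r ≤ s → s ≤ t →
    Q.real (Ico r s ×ˢ univ) ≤ (s / t) ^ θ * (θ * (Real.log s - Real.log r))

/-- The upper bound for `B` comes from the upper bound on the total mass and the lower bound for
`Bᶜ`. -/
lemma IsRenewalLaw.Ico_le (hT : IsRegularListing T) [IsProbabilityMeasure P] {t : ℝ}
    {Q : Measure (ℝ × (ℕ → ℝ))} (hQ : IsRenewalLaw T θ P t Q) {r s : ℝ} (hr : 0 < r) (hrs : r ≤ s)
    (hst : s ≤ t) {B : Set (ℕ → ℝ)} (hB : MeasurableSet B) :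
    Q.real (Ico r s ×ˢ B) ≤ (s / t) ^ θ * (θ * (Real.log s - Real.log r)) -
      (r / t) ^ θ * (θ * (Real.log s - Real.log r)) * (1 - P.real (past T r ⁻¹' B)) := by
  have := hQ.isFiniteMeasure
  have h1 := hQ.le_Ico r s hr hrs hst Bᶜ hB.compl
  have h2 := hQ.Ico_univ_le r s hr hrs hst
  have h3 : Q.real (Ico r s ×ˢ univ) = Q.real (Ico r s ×ˢ B) + Q.real (Ico r s ×ˢ Bᶜ) := by
    rw [← union_compl_self B, prod_union, measureReal_union]
    · exact Set.disjoint_prod.2 (Or.inr disjoint_compl_right)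
    · exact measurableSet_Ico.prod hB.compl
  have h4 : P.real (past T r ⁻¹' Bᶜ) = 1 - P.real (past T r ⁻¹' B) :=
    probReal_compl_eq_one_sub (hT.measurable_past_apply r hB)
  rw [h4] at h1
  linarith

/-- This difference is the gap between the upper and lower bounds on a renewal law over `[r, s)`.
With `m` the intensity of the interval, the factors `(r/t) ^ θ` and `(s/t) ^ θ` differ by the factor
`e^(-m)`. -/
lemma rpow_div_mul_le_sq (hθ : 0 < θ) {r s t : ℝ} (hr : 0 < r) (hrs : r ≤ s) (hst : s ≤ t) :
    (s / t) ^ θ * (θ * (Real.log s - Real.log r)) - (r / t) ^ θ * (θ * (Real.log s - Real.log r)) ≤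
      θ ^ 2 * (Real.log s - Real.log r) ^ 2 := by
  have hs := hr.trans_le hrs
  have ht := hs.trans_le hst
  set m := θ * (Real.log s - Real.log r) with hm
  have hm0 : 0 ≤ m := mul_nonneg hθ.le (sub_nonneg.2 (Real.log_le_log hr hrs))
  have h1 : (r / t) ^ θ = (s / t) ^ θ * Real.exp (-m) := by
    rw [Real.rpow_def_of_pos (by positivity), Real.rpow_def_of_pos (by positivity), ← Real.exp_add,
      Real.log_div hr.ne' ht.ne', Real.log_div hs.ne' ht.ne', hm]
    congr 1
    ring
  have h2 : (s / t) ^ θ ≤ 1 :=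
    Real.rpow_le_one (by positivity) ((div_le_one ht).2 hst) hθ.le
  have h3 : 0 ≤ (s / t) ^ θ := by positivity
  have h4 : 1 - Real.exp (-m) ≤ m := by linarith [Real.add_one_le_exp (-m)]
  have h5 : 0 ≤ 1 - Real.exp (-m) := by
    rw [sub_nonneg, Real.exp_le_one_iff]
    linarith
  rw [h1, show θ ^ 2 * (Real.log s - Real.log r) ^ 2 = m * m by rw [hm]; ring]
  calc (s / t) ^ θ * m - (s / t) ^ θ * Real.exp (-m) * m
      = (s / t) ^ θ * (1 - Real.exp (-m)) * m := by ring
    _ ≤ 1 * m * m := by gcongr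
    _ = m * m := by ring

/-- In the variable `u = log s`, the difference of the two distribution functions has increments of
second order, hence is constant; it tends to `0` as `u → -∞`. -/
lemma IsRenewalLaw.Iio_prod_eq (hT : IsRegularListing T) [IsProbabilityMeasure P] (hθ : 0 < θ)
    {t : ℝ} (ht : 0 < t) {Q Q' : Measure (ℝ × (ℕ → ℝ))} (hQ : IsRenewalLaw T θ P t Q)
    (hQ' : IsRenewalLaw T θ P t Q') {B : Set (ℕ → ℝ)} (hB : MeasurableSet B) (s : ℝ) :
    Q (Iio s ×ˢ B) = Q' (Iio s ×ˢ B) := by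
  have := hQ.isFiniteMeasure
  have := hQ'.isFiniteMeasure
  have hzero : ∀ R, IsRenewalLaw T θ P t R → R (Iic 0 ×ˢ B) = 0 := by
    intro R hR
    have hsub : Iic 0 ⊆ (Ioo 0 t)ᶜ := fun x (hx : x ≤ 0) (hx' : x ∈ Ioo 0 t) => hx.not_gt hx'.1
    exact measure_mono_null (prod_mono hsub (subset_univ _)) hR.compl_eq_zero
  have hmin : ∀ R, IsRenewalLaw T θ P t R → R (Iio s ×ˢ B) = R (Iio (min s t) ×ˢ B) := by
    intro R hR
    refine le_antisymm ?_ (measure_mono (prod_mono (Iio_subset_Iio (min_le_left _ _)) le_rfl))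
    have hsub : Iio s ×ˢ B ⊆ Iio (min s t) ×ˢ B ∪ (Ioo 0 t)ᶜ ×ˢ univ := by
      rintro ⟨x, y⟩ ⟨hx, hy⟩
      by_cases hxt : x < t
      · exact Or.inl ⟨lt_min hx hxt, hy⟩
      · exact Or.inr ⟨fun hx' => hxt hx'.2, trivial⟩
    refine (measure_mono hsub).trans ((measure_union_le _ _).trans ?_)
    rw [hR.compl_eq_zero, add_zero]
  rcases le_or_gt s 0 with hs | hs
  · have hz : ∀ R, IsRenewalLaw T θ P t R → R (Iio s ×ˢ B) = 0 := fun R hR =>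
      measure_mono_null (prod_mono (fun x (hx : x < s) => hx.le.trans hs) le_rfl) (hzero R hR)
    rw [hz Q hQ, hz Q' hQ']
  rw [hmin Q hQ, hmin Q' hQ']
  set L := Real.log t
  -- Capping `u` at `log t` makes the increment bound valid on all of `ℝ`, since the renewal bounds
  -- only concern intervals up to `t`.
  let F : ℝ → ℝ := fun u => Q.real (Iio (Real.exp (min u L)) ×ˢ B) -
    Q'.real (Iio (Real.exp (min u L)) ×ˢ B)
  have hexpL : ∀ u, Real.exp (min u L) ≤ t := fun u => by
    rw [← Real.le_log_iff_exp_le ht]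
    exact min_le_right _ _
  have hF : ∀ u v, u ≤ v → |F v - F u| ≤ θ ^ 2 * (v - u) ^ 2 := by
    intro u v huv
    have hmm : min u L ≤ min v L := min_le_min_right _ huv
    have hee := Real.exp_le_exp.2 hmm
    have hsplit : ∀ R, IsRenewalLaw T θ P t R → R.real (Iio (Real.exp (min v L)) ×ˢ B) =
        R.real (Iio (Real.exp (min u L)) ×ˢ B) +
          R.real (Ico (Real.exp (min u L)) (Real.exp (min v L)) ×ˢ B) := by
      intro R hR
      have := hR.isFiniteMeasure
      rw [← Iio_union_Ico_eq_Iio hee, union_prod, measureReal_union]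
      · refine Set.disjoint_prod.2 (Or.inl (Set.disjoint_left.2 fun x hx hx' => ?_))
        exact (mem_Iio.1 hx).not_ge hx'.1
      · exact measurableSet_Ico.prod hB
    have l1 := hQ.le_Ico _ _ (Real.exp_pos _) hee (hexpL v) B hB
    have l2 := hQ'.le_Ico _ _ (Real.exp_pos _) hee (hexpL v) B hB
    have u1 := hQ.Ico_le hT (Real.exp_pos _) hee (hexpL v) hB
    have u2 := hQ'.Ico_le hT (Real.exp_pos _) hee (hexpL v) hB
    have hsq := rpow_div_mul_le_sq hθ (Real.exp_pos _) hee (hexpL v)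
    have hle : θ ^ 2 * (min v L - min u L) ^ 2 ≤ θ ^ 2 * (v - u) ^ 2 := by
      have h1 : 0 ≤ min v L - min u L := sub_nonneg.2 hmm
      have h2 : min v L - min u L ≤ v - u := by
        rcases le_total u L with hu | hu
        · rw [min_eq_left hu]
          linarith [min_le_left v L]
        · rw [min_eq_right hu, min_eq_right (hu.trans huv)]
          linarith
      gcongr
    simp only [F]
    rw [hsplit Q hQ, hsplit Q' hQ']
    simp only [Real.log_exp] at l1 l2 u1 u2 hsq
    rw [abs_le]
    constructor <;> linarith
  have hlim : Tendsto (fun n : ℕ => F (-n)) atTop (𝓝 0) := by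
    have hR : ∀ R, IsRenewalLaw T θ P t R →
        Tendsto (fun n : ℕ => R.real (Iio (Real.exp (min (-n : ℝ) L)) ×ˢ B)) atTop (𝓝 0) := by
      intro R hR
      have := hR.isFiniteMeasure
      have h1 : Tendsto (fun n : ℕ => R (Iio (Real.exp (min (-n : ℝ) L)) ×ˢ B)) atTop
          (𝓝 (R (⋂ n : ℕ, Iio (Real.exp (min (-n : ℝ) L)) ×ˢ B))) := by
        refine tendsto_measure_iInter_atTop
          (fun n => (measurableSet_Iio.prod hB).nullMeasurableSet) ?_ ⟨0, measure_ne_top _ _⟩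
        intro m n hmn
        refine prod_mono (Iio_subset_Iio (Real.exp_le_exp.2 (min_le_min_right _ ?_))) le_rfl
        simpa using hmn
      have h2 : R (⋂ n : ℕ, Iio (Real.exp (min (-n : ℝ) L)) ×ˢ B) = 0 := by
        refine measure_mono_null ?_ (hzero R hR)
        rintro ⟨x, y⟩ hxy
        rw [mem_iInter] at hxy
        refine ⟨?_, (hxy 0).2⟩
        by_contra! hx
        obtain ⟨n, hn⟩ := exists_nat_gt (-Real.log x)
        have h3 := (hxy n).1
        have h4 : Real.exp (min (-n : ℝ) L) ≤ x := by
          rw [← Real.le_log_iff_exp_le (by simpa using hx)]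
          exact (min_le_left _ _).trans (by linarith)
        exact absurd h3 (not_lt.2 h4)
      rw [h2] at h1
      have h3 := (ENNReal.tendsto_toReal ENNReal.zero_ne_top).comp h1
      rw [ENNReal.toReal_zero] at h3
      exact h3
    simpa using (hR Q hQ).sub (hR Q' hQ')
  have hF0 : F (Real.log (min s t)) = 0 := by
    have hc : ∀ n : ℕ, F (-n) = F (Real.log (min s t)) := fun n =>
      eq_of_abs_sub_le_mul_sq hF _ _
    simp_rw [hc] at hlim
    exact tendsto_nhds_unique tendsto_const_nhds hlim
  have hst : 0 < min s t := lt_min hs ht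
  have hle : Real.log (min s t) ≤ L := Real.log_le_log hst (min_le_right _ _)
  simp only [F, min_eq_left hle, Real.exp_log hst] at hF0
  rw [← measureReal_eq_measureReal_iff]
  linarith

/-- There is at most one joint law of the last point before `t` and of the sequence of points
before it. -/
theorem IsRenewalLaw.unique (hT : IsRegularListing T) [IsProbabilityMeasure P] (hθ : 0 < θ)
    {t : ℝ} (ht : 0 < t) {Q Q' : Measure (ℝ × (ℕ → ℝ))} (hQ : IsRenewalLaw T θ P t Q)
    (hQ' : IsRenewalLaw T θ P t Q') : Q = Q' := by
  have := hQ.isFiniteMeasure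
  have := hQ'.isFiniteMeasure
  refine Measure.ext_prod fun {A B} hA hB => ?_
  have key : ∀ R : Measure (ℝ × (ℕ → ℝ)), ∀ A : Set ℝ, MeasurableSet A →
      ((R.restrict (univ ×ˢ B)).map Prod.fst) A = R (A ×ˢ B) := by
    intro R A hA
    rw [Measure.map_apply measurable_fst hA, Measure.restrict_apply (measurable_fst hA)]
    congr 1
    ext ⟨x, y⟩
    simp
  rw [← key Q A hA, ← key Q' A hA]
  congr 1
  have huniv : ∀ R, IsRenewalLaw T θ P t R → R (univ ×ˢ B) = R (Iio t ×ˢ B) := by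
    intro R hR
    refine le_antisymm ?_ (measure_mono (prod_mono (subset_univ _) le_rfl))
    have hsub : univ ×ˢ B ⊆ Iio t ×ˢ B ∪ (Ioo 0 t)ᶜ ×ˢ univ := by
      rintro ⟨x, y⟩ ⟨-, hy⟩
      by_cases hxt : x < t
      · exact Or.inl ⟨hxt, hy⟩
      · exact Or.inr ⟨fun hx' => hxt hx'.2, trivial⟩
    refine (measure_mono hsub).trans ((measure_union_le _ _).trans ?_)
    rw [hR.compl_eq_zero, add_zero]
  refine ext_of_generate_finite (range Iio) ?_ isPiSystem_Iio ?_ ?_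
  · rw [← borel_eq_generateFrom_Iio, BorelSpace.measurable_eq (α := ℝ)]
  · rintro _ ⟨s, rfl⟩
    rw [key Q _ measurableSet_Iio, key Q' _ measurableSet_Iio]
    exact hQ.Iio_prod_eq hT hθ ht hQ' hB s
  · rw [key Q _ .univ, key Q' _ .univ, huniv Q hQ, huniv Q' hQ']
    exact hQ.Iio_prod_eq hT hθ ht hQ' hB t

end Renewal

/-! ### The renewal law, realised by the past itself and by an independent restart. -/

section RenewalLaw

variable {Ω : Type*} [MeasurableSpace Ω] {T : ℤ → Ω → ℝ} {P : Measure Ω} {θ : ℝ}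

lemma IsRegularListing.measure_past_inter_eq_zero (hT : IsRegularListing T)
    [IsProbabilityMeasure P] (hθ : 0 < θ) (hPPP : IsScaleInvariantPPP T θ P) {r s : ℝ}
    (hr : 0 < r) (hrs : r ≤ s) {B : Set (ℕ → ℝ)} (hB : MeasurableSet B) :
    P (past T r ⁻¹' B ∩ {ω | pointProcess T ω (Ico r s) = 0}) =
      P (past T r ⁻¹' B) * ENNReal.ofReal ((r / s) ^ θ) := by
  have hind := hT.indepFun_past hPPP hr (C := fun _ : Unit => Ico r s)
    (fun _ => measurableSet_Ico) (Subsingleton.pairwise) fun _ => Ico_subset_Ici_self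
  have := hind.measure_inter_preimage_eq_mul _ {y | y () = 0} hB
    (measurable_pi_apply () (measurableSet_singleton 0))
  rw [← IsScaleInvariantPPP.measure_Ico_eq_zero hθ hPPP hr hrs]
  exact this

lemma IsRegularListing.measure_past_inter_eq_one (hT : IsRegularListing T)
    [IsProbabilityMeasure P] (hθ : 0 < θ) (hPPP : IsScaleInvariantPPP T θ P) {r s t : ℝ}
    (hr : 0 < r) (hrs : r ≤ s) (hst : s ≤ t) {B : Set (ℕ → ℝ)} (hB : MeasurableSet B) :
    P (past T r ⁻¹' B ∩ {ω | pointProcess T ω (Ico r s) = 1 ∧ pointProcess T ω (Ico s t) = 0}) =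
      P (past T r ⁻¹' B) * (ENNReal.ofReal ((r / s) ^ θ * (θ * (Real.log s - Real.log r))) *
        ENNReal.ofReal ((s / t) ^ θ)) := by
  let C : Bool → Set ℝ := fun b => bif b then Ico r s else Ico s t
  have hC : ∀ b, MeasurableSet (C b) := by
    rintro (_ | _) <;> exact measurableSet_Ico
  have hdis : Disjoint (Ico r s) (Ico s t) :=
    Set.disjoint_left.2 fun x hx hx' => hx.2.not_ge hx'.1
  have hd : Pairwise (Disjoint on C) := by
    rintro (_ | _) (_ | _) hne
    · exact absurd rfl hne
    · exact hdis.symm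
    · exact hdis
    · exact absurd rfl hne
  have hind := hT.indepFun_past hPPP hr hC hd (by
    rintro (_ | _)
    · exact fun x hx => hrs.trans hx.1
    · exact fun x hx => hx.1)
  have hset : MeasurableSet {y : Bool → ℝ≥0∞ | y true = 1 ∧ y false = 0} :=
    (measurable_pi_apply true (measurableSet_singleton 1)).inter
      (measurable_pi_apply false (measurableSet_singleton 0))
  have h1 := hind.measure_inter_preimage_eq_mul _ _ hB hset
  have hind2 := (hPPP.iIndepFun_apply hC hd).indepFun (i := true) (j := false) (by simp)
  have h2 := hind2.measure_inter_preimage_eq_mul {1} {0} (measurableSet_singleton _)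
    (measurableSet_singleton _)
  rw [← IsScaleInvariantPPP.measure_Ico_eq_one hθ hPPP hr hrs,
    ← IsScaleInvariantPPP.measure_Ico_eq_zero hθ hPPP (hr.trans_le hrs) hst]
  refine h1.trans ?_
  congr 1

/-- The joint law of the last point before `t` and of the sequence of points before it. -/
def pastLaw (T : ℤ → Ω → ℝ) (P : Measure Ω) (t : ℝ) : Measure (ℝ × (ℕ → ℝ)) :=
  P.map fun ω => (past T t ω 0, fun k => past T t ω (k + 1))

lemma IsRegularListing.measurable_pastPair (hT : IsRegularListing T) (t : ℝ) :
    Measurable fun ω => (past T t ω 0, fun k => past T t ω (k + 1)) := by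
  have h := hT.measurable_past_apply t
  exact ((measurable_pi_apply 0).comp h).prodMk
    (measurable_pi_lambda _ fun k => (measurable_pi_apply (k + 1)).comp h)

/-- The last point is before `s` exactly when `[s, t)` is empty, so this is a void probability. -/
lemma IsRegularListing.measureReal_past_zero_lt (hT : IsRegularListing T) (hθ : 0 < θ)
    (hPPP : IsScaleInvariantPPP T θ P) {s t : ℝ} (hs : 0 < s) (hst : s ≤ t) :
    P.real {ω | past T t ω 0 < s} = (s / t) ^ θ := by
  have : {ω | past T t ω 0 < s} = {ω | pointProcess T ω (Ico s t) = 0} := by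
    ext ω
    have := hT.past_lt_iff (hs.trans_le hst) ω 0 s
    simpa using this
  rw [this, Measure.real, IsScaleInvariantPPP.measure_Ico_eq_zero hθ hPPP hs hst,
    ENNReal.toReal_ofReal (Real.rpow_nonneg (div_nonneg hs.le (hs.trans_le hst).le) _)]

/-- Lower bound: if `[r, s)` holds one point and `[s, t)` none, the points before the last one are
exactly those before `r`, which are independent of these counts. Upper bound: the last point lies in
`[r, s)` with probability `(s/t) ^ θ - (r/t) ^ θ`. -/
lemma isRenewalLaw_pastLaw (hT : IsRegularListing T) [IsProbabilityMeasure P] (hθ : 0 < θ)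
    (hPPP : IsScaleInvariantPPP T θ P) {t : ℝ} (ht : 0 < t) :
    IsRenewalLaw T θ P t (pastLaw T P t) where
  isFiniteMeasure := by
    unfold pastLaw
    infer_instance
  compl_eq_zero := by
    rw [pastLaw, Measure.map_apply (hT.measurable_pastPair t)
      (measurableSet_Ioo.compl.prod .univ)]
    convert! measure_empty (μ := P)
    ext ω
    simpa using ⟨hT.past_pos t ω 0, hT.past_lt ht ω 0⟩
  le_Ico r s hr hrs hst B hB := by
    have hs := hr.trans_le hrs
    have hm : 0 ≤ θ * (Real.log s - Real.log r) :=
      mul_nonneg hθ.le (sub_nonneg.2 (Real.log_le_log hr hrs))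
    have h1 := hT.measure_past_inter_eq_one hθ hPPP hr hrs hst hB
    have h2 : past T r ⁻¹' B ∩
        {ω | pointProcess T ω (Ico r s) = 1 ∧ pointProcess T ω (Ico s t) = 0} ⊆
        (fun ω => (past T t ω 0, fun k => past T t ω (k + 1))) ⁻¹' (Ico r s ×ˢ B) := by
      rintro ω ⟨hω, hω1, hω0⟩
      have h3 := hT.past_of_eq_one hr hrs hω1
      rw [mem_preimage, hT.past_eq_of_eq_zero hs hst hω0, h3.2]
      exact ⟨h3.1, hω⟩
    rw [pastLaw, map_measureReal_apply (hT.measurable_pastPair t) (measurableSet_Ico.prod hB)]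
    refine le_trans (le_of_eq ?_) (ENNReal.toReal_mono (measure_ne_top _ _) (measure_mono h2))
    rw [h1, ENNReal.toReal_mul, ENNReal.toReal_mul, ENNReal.toReal_ofReal (by positivity),
      ENNReal.toReal_ofReal (by positivity), Measure.real,
      Real.div_rpow hr.le ht.le, Real.div_rpow hr.le hs.le, Real.div_rpow hs.le ht.le]
    have : s ^ θ ≠ 0 := (Real.rpow_pos_of_pos hs _).ne'
    field_simp
  Ico_univ_le r s hr hrs hst := by
    have hs := hr.trans_le hrs
    rw [pastLaw, map_measureReal_apply (hT.measurable_pastPair t) (measurableSet_Ico.prod .univ)]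
    have hset : (fun ω => (past T t ω 0, fun k => past T t ω (k + 1))) ⁻¹' (Ico r s ×ˢ univ) =
        {ω | past T t ω 0 < s} \ {ω | past T t ω 0 < r} := by
      ext ω
      simp [and_comm]
    have hmeas : Measurable fun ω => past T t ω 0 :=
      (measurable_pi_apply 0).comp (hT.measurable_past_apply t)
    have hsub : {ω | past T t ω 0 < r} ⊆ {ω | past T t ω 0 < s} :=
      fun ω (hω : _ < r) => lt_of_lt_of_le hω hrs
    rw [hset, measureReal_sdiff hsub (measurableSet_lt hmeas measurable_const),
      hT.measureReal_past_zero_lt hθ hPPP hs hst,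
      hT.measureReal_past_zero_lt hθ hPPP hr (hrs.trans hst)]
    have h1 : (r / t) ^ θ = (s / t) ^ θ * Real.exp (-(θ * (Real.log s - Real.log r))) := by
      rw [Real.rpow_def_of_pos (by positivity), Real.rpow_def_of_pos (by positivity),
        ← Real.exp_add, Real.log_div hr.ne' ht.ne', Real.log_div hs.ne' ht.ne']
      congr 1
      ring
    rw [h1]
    have h3 : 0 ≤ (s / t) ^ θ := by positivity
    nlinarith [Real.add_one_le_exp (-(θ * (Real.log s - Real.log r)))]

/-- The law of the last point before `t`. -/
def lastLaw (θ t : ℝ) : Measure ℝ :=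
  ((scaleInvariantIntensity θ).restrict (Iio t)).withDensity fun s => ENNReal.ofReal ((s / t) ^ θ)

lemma measurable_ofReal_div_rpow (θ t : ℝ) :
    Measurable fun s : ℝ => ENNReal.ofReal ((s / t) ^ θ) := by fun_prop

lemma lintegral_lastLaw (θ : ℝ) {t : ℝ} {f : ℝ → ℝ≥0∞} (hf : Measurable f) :
    ∫⁻ s, f s ∂lastLaw θ t =
      ∫⁻ s in Ioo 0 t, ENNReal.ofReal (θ / s) * (ENNReal.ofReal ((s / t) ^ θ) * f s) := by
  rw [lastLaw, lintegral_withDensity_eq_lintegral_mul _ (measurable_ofReal_div_rpow θ t) hf,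
    ← lintegral_indicator measurableSet_Iio, lintegral_scaleInvariantIntensity _
      (((measurable_ofReal_div_rpow θ t).mul hf).indicator measurableSet_Iio),
    ← Ioi_inter_Iio, inter_comm, ← Measure.restrict_restrict measurableSet_Iio,
    ← lintegral_indicator measurableSet_Iio]
  refine lintegral_congr fun x => ?_
  by_cases hx : x ∈ Iio t <;> simp [hx]

lemma lastLaw_compl (θ t : ℝ) : lastLaw θ t (Ioo 0 t)ᶜ = 0 := by
  rw [← lintegral_indicator_one measurableSet_Ioo.compl, lintegral_lastLaw θ
    (measurable_one.indicator measurableSet_Ioo.compl)]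
  refine (setLIntegral_congr_fun measurableSet_Ioo fun x hx => ?_).trans (lintegral_zero)
  simp [hx]

lemma isFiniteMeasure_lastLaw (hθ : 0 < θ) {t : ℝ} (ht : 0 < t) :
    IsFiniteMeasure (lastLaw θ t) := by
  refine ⟨?_⟩
  rw [← lintegral_one, lintegral_lastLaw θ measurable_const]
  -- This is the density of `lastLaw`; the exponent exceeds `-1` because `θ > 0`.
  have hint : IntegrableOn (fun s : ℝ => θ / t ^ θ * s ^ (θ - 1)) (Ioo 0 t) := by
    refine Integrable.const_mul ?_ _
    have := intervalIntegral.intervalIntegrable_rpow' (a := 0) (b := t) (r := θ - 1) (by linarith)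
    rw [intervalIntegrable_iff_integrableOn_Ioo_of_le ht.le] at this
    exact this
  refine lt_of_le_of_lt (le_of_eq ?_) hint.lintegral_lt_top
  refine setLIntegral_congr_fun measurableSet_Ioo fun x hx => ?_
  have hx0 : 0 < x := hx.1
  have ht0 : t ^ θ ≠ 0 := (Real.rpow_pos_of_pos ht _).ne'
  rw [mul_one, ← ENNReal.ofReal_mul (by positivity), Real.div_rpow hx0.le ht.le,
    Real.rpow_sub_one hx0.ne']
  congr 1
  field_simp

lemma le_lastLaw_lintegral {t r s : ℝ} {c : ℝ≥0∞} {f : ℝ → ℝ≥0∞} (hf : Measurable f) (hst : s ≤ t)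
    (h : ∀ x ∈ Ico r s, c ≤ ENNReal.ofReal ((x / t) ^ θ) * f x) :
    scaleInvariantIntensity θ (Ico r s) * c ≤ ∫⁻ x in Ico r s, f x ∂lastLaw θ t := by
  rw [lastLaw, restrict_withDensity measurableSet_Ico, lintegral_withDensity_eq_lintegral_mul _
    (measurable_ofReal_div_rpow θ t) hf, Measure.restrict_restrict measurableSet_Ico,
    inter_eq_left.2 fun x (hx : x ∈ Ico r s) => mem_Iio.2 (hx.2.trans_le hst), mul_comm,
    ← setLIntegral_const]
  exact setLIntegral_mono ((measurable_ofReal_div_rpow θ t).mul hf) h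

lemma lastLaw_Ico_le (hθ : 0 < θ) {r s t : ℝ} (hr : 0 < r) (hrs : r ≤ s) (hst : s ≤ t) :
    lastLaw θ t (Ico r s) ≤
      ENNReal.ofReal ((s / t) ^ θ * (θ * (Real.log s - Real.log r))) := by
  have ht := (hr.trans_le hrs).trans_le hst
  rw [lastLaw, withDensity_apply _ measurableSet_Ico, Measure.restrict_restrict measurableSet_Ico,
    inter_eq_left.2 fun x (hx : x ∈ Ico r s) => mem_Iio.2 (hx.2.trans_le hst),
    ENNReal.ofReal_mul (Real.rpow_nonneg (div_nonneg (hr.trans_le hrs).le ht.le) _),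
    ← scaleInvariantIntensity_Ico hθ hr hrs, ← setLIntegral_const]
  refine setLIntegral_mono measurable_const fun x hx => ENNReal.ofReal_le_ofReal ?_
  have := hr.trans_le hx.1
  have := hx.2.le
  gcongr

/-- The joint law of `X` with law `lastLaw θ t` and of the sequence of points before `X`, for `X`
independent of the points. -/
def renewedLaw (T : ℤ → Ω → ℝ) (θ : ℝ) (P : Measure Ω) (t : ℝ) : Measure (ℝ × (ℕ → ℝ)) :=
  ((lastLaw θ t).prod P).map fun p => (p.1, past T p.1 p.2)

lemma IsRegularListing.measurable_fst_past (hT : IsRegularListing T) :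
    Measurable fun p : ℝ × Ω => (p.1, past T p.1 p.2) := measurable_fst.prodMk hT.measurable_past

lemma renewedLaw_prod (hT : IsRegularListing T) [IsProbabilityMeasure P] {t : ℝ} {A : Set ℝ}
    (hA : MeasurableSet A) {B : Set (ℕ → ℝ)} (hB : MeasurableSet B) :
    renewedLaw T θ P t (A ×ˢ B) = ∫⁻ s in A, P (past T s ⁻¹' B) ∂lastLaw θ t := by
  rw [renewedLaw, Measure.map_apply hT.measurable_fst_past (hA.prod hB),
    Measure.prod_apply (hT.measurable_fst_past (hA.prod hB)), ← lintegral_indicator hA]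
  refine lintegral_congr fun s => ?_
  by_cases hs : s ∈ A
  · rw [indicator_of_mem hs]
    congr 1
    ext ω
    simp [hs]
  · rw [indicator_of_notMem hs]
    convert! measure_empty (μ := P)
    ext ω
    simp [hs]

lemma IsRegularListing.measurable_measure_past (hT : IsRegularListing T) [IsProbabilityMeasure P]
    {B : Set (ℕ → ℝ)} (hB : MeasurableSet B) : Measurable fun s => P (past T s ⁻¹' B) :=
  measurable_measure_prodMk_left (hT.measurable_past hB)

/-- For `x` in `[r, s)` the pasts at `x` and at `r` agree if `[r, x)` is empty, which has
probability `(r/x) ^ θ` independently of the past at `r`. The factor `(x/t) ^ θ` of the density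
turns this into `(r/t) ^ θ`, free of `x`. -/
lemma isRenewalLaw_renewedLaw (hT : IsRegularListing T) [IsProbabilityMeasure P] (hθ : 0 < θ)
    (hPPP : IsScaleInvariantPPP T θ P) {t : ℝ} (ht : 0 < t) :
    IsRenewalLaw T θ P t (renewedLaw T θ P t) := by
  have := isFiniteMeasure_lastLaw hθ ht
  have hfin : IsFiniteMeasure (renewedLaw T θ P t) := by
    unfold renewedLaw
    infer_instance
  refine ⟨hfin, ?_, fun r s hr hrs hst B hB => ?_, fun r s hr hrs hst => ?_⟩
  · rw [renewedLaw_prod hT measurableSet_Ioo.compl .univ]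
    simp [lastLaw_compl]
  · have hs := hr.trans_le hrs
    have hm : 0 ≤ θ * (Real.log s - Real.log r) :=
      mul_nonneg hθ.le (sub_nonneg.2 (Real.log_le_log hr hrs))
    have hle := le_lastLaw_lintegral (θ := θ) (c := ENNReal.ofReal ((r / t) ^ θ) *
      P (past T r ⁻¹' B)) (hT.measurable_measure_past hB (P := P)) hst (r := r) fun x hx => by
        have hx0 : 0 < x := hr.trans_le hx.1
        have h1 := hT.measure_past_inter_eq_zero hθ hPPP hr hx.1 hB
        have h2 : past T r ⁻¹' B ∩ {ω | pointProcess T ω (Ico r x) = 0} ⊆ past T x ⁻¹' B := by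
          rintro ω ⟨hω, hω0⟩
          rw [mem_preimage, hT.past_eq_of_eq_zero hr hx.1 hω0]
          exact hω
        refine le_trans (le_of_eq ?_) (mul_le_mul_right (measure_mono h2) _)
        rw [h1, mul_left_comm, ← ENNReal.ofReal_mul (by positivity), mul_comm]
        congr 2
        rw [← Real.mul_rpow (by positivity) (by positivity)]
        congr 1
        field_simp
    rw [← renewedLaw_prod hT measurableSet_Ico hB, scaleInvariantIntensity_Ico hθ hr hrs] at hle
    have := ENNReal.toReal_mono (measure_ne_top _ _) hle
    rw [ENNReal.toReal_mul, ENNReal.toReal_mul, ENNReal.toReal_ofReal hm,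
      ENNReal.toReal_ofReal (by positivity)] at this
    refine le_trans (le_of_eq ?_) this
    rw [Measure.real]
    ring
  · have hs := hr.trans_le hrs
    have hm : 0 ≤ θ * (Real.log s - Real.log r) :=
      mul_nonneg hθ.le (sub_nonneg.2 (Real.log_le_log hr hrs))
    refine ENNReal.toReal_le_of_le_ofReal (by positivity) ?_
    rw [renewedLaw_prod hT measurableSet_Ico .univ]
    simpa using lastLaw_Ico_le hθ hr hrs hst

/-- Given that the last point before `t` is at `s`, the points before it are distributed as the
points before `s`. -/
theorem pastLaw_eq_renewedLaw (hT : IsRegularListing T) [IsProbabilityMeasure P] (hθ : 0 < θ)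
    (hPPP : IsScaleInvariantPPP T θ P) {t : ℝ} (ht : 0 < t) :
    pastLaw T P t = renewedLaw T θ P t :=
  (isRenewalLaw_pastLaw hT hθ hPPP ht).unique hT hθ ht (isRenewalLaw_renewedLaw hT hθ hPPP ht)

theorem lintegral_past_eq (hT : IsRegularListing T) [IsProbabilityMeasure P] (hθ : 0 < θ)
    (hPPP : IsScaleInvariantPPP T θ P) {t : ℝ} (ht : 0 < t) {H : ℝ × (ℕ → ℝ) → ℝ≥0∞}
    (hH : Measurable H) :
    ∫⁻ ω, H (past T t ω 0, fun k => past T t ω (k + 1)) ∂P =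
      ∫⁻ s in Ioo 0 t, ENNReal.ofReal (θ / s) * (ENNReal.ofReal ((s / t) ^ θ) *
        ∫⁻ ω, H (s, past T s ω) ∂P) := by
  have hm : Measurable fun p : ℝ × Ω => H (p.1, past T p.1 p.2) := hH.comp hT.measurable_fst_past
  have := isFiniteMeasure_lastLaw hθ ht
  rw [← lintegral_map hH (hT.measurable_pastPair t)]
  change ∫⁻ y, H y ∂pastLaw T P t = _
  rw [pastLaw_eq_renewedLaw hT hθ hPPP ht, renewedLaw, lintegral_map hH hT.measurable_fst_past,
    lintegral_prod _ hm.aemeasurable, lintegral_lastLaw θ hm.lintegral_prod_right']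

end RenewalLaw

/-! ### The limit of the solution of the renewal equation -/

section Density

variable {p f : ℝ → ℝ} {S : Set ℝ}

/-- The measure with density `p` on the set `S`. -/
def densityOn (p : ℝ → ℝ) (S : Set ℝ) : Measure ℝ :=
  (volume.restrict S).withDensity fun x => ENNReal.ofReal (p x)

lemma integral_densityOn (hp : Measurable p) (hS : MeasurableSet S) (hp0 : ∀ x ∈ S, 0 ≤ p x)
    (f : ℝ → ℝ) : ∫ x, f x ∂densityOn p S = ∫ x in S, p x * f x := by
  rw [densityOn, integral_withDensity_eq_integral_toReal_smul (by fun_prop)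
    (ae_of_all _ fun x => ENNReal.ofReal_lt_top)]
  refine setIntegral_congr_fun hS fun x hx => ?_
  simp [ENNReal.toReal_ofReal (hp0 x hx)]

lemma integrable_densityOn_iff (hp : Measurable p) (hS : MeasurableSet S)
    (hp0 : ∀ x ∈ S, 0 ≤ p x) : Integrable f (densityOn p S) ↔
      IntegrableOn (fun x => p x * f x) S := by
  rw [densityOn, integrable_withDensity_iff_integrable_smul' (by fun_prop)
    (ae_of_all _ fun x => ENNReal.ofReal_lt_top)]
  refine integrable_congr ?_
  filter_upwards [ae_restrict_mem hS] with x hx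
  simp [ENNReal.toReal_ofReal (hp0 x hx)]

end Density

section RenewalEquation

variable {θ : ℝ} {φ g : ℝ → ℝ}

/-- The Laplace transform turns the convolution into a product. Stated in `[0, ∞]`, Tonelli's
theorem applies with no integrability condition. -/
lemma lintegral_exp_renewal (hφm : Measurable φ) (hφ0 : ∀ t, 0 ≤ φ t) (hgm : Measurable g)
    (hθ : 0 < θ)
    (heq : ∀ t > 0, ENNReal.ofReal (t ^ θ * φ t) =
      ∫⁻ s in Ioo 0 t, ENNReal.ofReal (θ * (s ^ (θ - 1) * φ s)) * ENNReal.ofReal (g (t - s)))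
    (w : ℝ) :
    ∫⁻ t in Ioi 0, ENNReal.ofReal (Real.exp (-(w * t)) * (t ^ θ * φ t)) =
      (∫⁻ s in Ioi 0, ENNReal.ofReal (Real.exp (-(w * s)) * (θ * (s ^ (θ - 1) * φ s)))) *
        ∫⁻ x in Ioi 0, ENNReal.ofReal (Real.exp (-(w * x)) * g x) := by
  let p : ℝ → ℝ≥0∞ := (Ioi 0).indicator fun s =>
    ENNReal.ofReal (Real.exp (-(w * s)) * (θ * (s ^ (θ - 1) * φ s)))
  let q : ℝ → ℝ≥0∞ := (Ioi 0).indicator fun x => ENNReal.ofReal (Real.exp (-(w * x)) * g x)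
  have hp : Measurable p := Measurable.indicator (by fun_prop) measurableSet_Ioi
  have hq : Measurable q := Measurable.indicator (by fun_prop) measurableSet_Ioi
  have hconv : ∫⁻ t, ∫⁻ s, p s * q (t - s) = (∫⁻ s, p s) * ∫⁻ x, q x := by
    rw [lintegral_lintegral_swap (by fun_prop), ← lintegral_mul_const _ hp]
    refine lintegral_congr fun s => ?_
    rw [lintegral_const_mul _ (by fun_prop), lintegral_sub_right_eq_self q s]
  rw [← lintegral_indicator measurableSet_Ioi, ← lintegral_indicator measurableSet_Ioi,
    ← lintegral_indicator measurableSet_Ioi, ← hconv]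
  refine lintegral_congr fun t => ?_
  by_cases ht : 0 < t
  · rw [indicator_of_mem (mem_Ioi.2 ht), ENNReal.ofReal_mul (Real.exp_pos _).le, heq t ht,
      ← lintegral_const_mul _ (by fun_prop), ← lintegral_indicator measurableSet_Ioo]
    refine lintegral_congr fun s => ?_
    by_cases hs : s ∈ Ioo 0 t
    · have hs1 : 0 < s := hs.1
      have hs2 : 0 < t - s := sub_pos.2 hs.2
      have h1 : 0 ≤ θ * (s ^ (θ - 1) * φ s) := by
        have := hφ0 s
        positivity
      simp only [p, q]
      rw [indicator_of_mem hs, indicator_of_mem (mem_Ioi.2 hs1), indicator_of_mem (mem_Ioi.2 hs2),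
        ENNReal.ofReal_mul (Real.exp_pos _).le, ENNReal.ofReal_mul (Real.exp_pos _).le,
        show -(w * t) = -(w * s) + -(w * (t - s)) by ring, Real.exp_add,
        ENNReal.ofReal_mul (Real.exp_pos _).le]
      ring
    · rw [indicator_of_notMem hs]
      by_cases hs1 : 0 < s
      · have : t - s ∉ Ioi 0 := fun h => hs ⟨hs1, sub_pos.1 h⟩
        simp [q, this]
      · simp [p, hs1]
  · rw [indicator_of_notMem (by simpa using ht)]
    symm
    rw [lintegral_eq_zero_iff (by fun_prop)]
    refine ae_of_all _ fun s => ?_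
    by_cases hs1 : 0 < s
    · have : ¬ s < t := fun h => ht (hs1.trans h)
      simp [q, this]
    · simp [p, hs1]

lemma integral_exp_renewal (hφm : Measurable φ) (hφ0 : ∀ t, 0 ≤ φ t) (hgm : Measurable g)
    (hg0 : ∀ x, 0 ≤ g x) (hθ : 0 < θ)
    (heq : ∀ t > 0, ENNReal.ofReal (t ^ θ * φ t) =
      ∫⁻ s in Ioo 0 t, ENNReal.ofReal (θ * (s ^ (θ - 1) * φ s)) * ENNReal.ofReal (g (t - s)))
    (w : ℝ) :
    ∫ t in Ioi 0, Real.exp (-(w * t)) * (t ^ θ * φ t) =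
      θ * (∫ s in Ioi 0, Real.exp (-(w * s)) * (s ^ (θ - 1) * φ s)) *
        ∫ x in Ioi 0, Real.exp (-(w * x)) * g x := by
  have h := congrArg ENNReal.toReal (lintegral_exp_renewal hφm hφ0 hgm hθ heq w)
  rw [ENNReal.toReal_mul, ← integral_eq_lintegral_of_nonneg_ae,
    ← integral_eq_lintegral_of_nonneg_ae, ← integral_eq_lintegral_of_nonneg_ae] at h
  · have h1 : ∫ s in Ioi 0, Real.exp (-(w * s)) * (θ * (s ^ (θ - 1) * φ s)) =
        θ * ∫ s in Ioi 0, Real.exp (-(w * s)) * (s ^ (θ - 1) * φ s) := by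
      rw [← integral_const_mul]
      refine integral_congr_ae (ae_of_all _ fun s => ?_)
      dsimp only
      ring
    rw [h, h1]
  · exact ae_of_all _ fun x => mul_nonneg (Real.exp_pos _).le (hg0 x)
  · exact Measurable.aestronglyMeasurable (by fun_prop)
  · filter_upwards [ae_restrict_mem measurableSet_Ioi] with x hx
    have h1 : (0 : ℝ) < x := hx
    have := hφ0 x
    dsimp
    positivity
  · exact Measurable.aestronglyMeasurable (by fun_prop)
  · filter_upwards [ae_restrict_mem measurableSet_Ioi] with x hx
    have h1 : (0 : ℝ) < x := hx
    have := hφ0 x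
    dsimp
    positivity
  · exact Measurable.aestronglyMeasurable (by fun_prop)

/-- Abelian statement: substituting `u = w s` gives `∫ e^(-u) u ^ (θ - 1) φ(u/w) du`, dominated by
the Gamma integrand. The filter is general because it serves both `w → ∞` and `w → 0+`. -/
lemma tendsto_rpow_mul_integral (hθ : 0 < θ) (hφm : Measurable φ) (hφ0 : ∀ t, 0 ≤ φ t)
    (hφ1 : ∀ t, φ t ≤ 1) {l : Filter ℝ} [l.IsCountablyGenerated] (hl : ∀ᶠ w in l, 0 < w) {d : ℝ}
    (hd : ∀ u > 0, Tendsto (fun w => φ (u / w)) l (𝓝 d)) :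
    Tendsto (fun w => w ^ θ * ∫ s in Ioi 0, Real.exp (-(w * s)) * (s ^ (θ - 1) * φ s)) l
      (𝓝 (d * Real.Gamma θ)) := by
  have hlim : Tendsto (fun w => ∫ u in Ioi 0, Real.exp (-u) * u ^ (θ - 1) * φ (u / w)) l
      (𝓝 (∫ u in Ioi 0, Real.exp (-u) * u ^ (θ - 1) * d)) := by
    refine tendsto_integral_filter_of_dominated_convergence
      (fun u => Real.exp (-u) * u ^ (θ - 1)) (Eventually.of_forall fun w =>
        Measurable.aestronglyMeasurable (by fun_prop)) (Eventually.of_forall fun w => ?_)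
      (Real.GammaIntegral_convergent hθ) ?_
    · filter_upwards [ae_restrict_mem measurableSet_Ioi] with u hu
      have hu' : (0 : ℝ) < u := hu
      have h0 := hφ0 (u / w)
      rw [Real.norm_of_nonneg (by positivity)]
      exact mul_le_of_le_one_right (by positivity) (hφ1 _)
    · filter_upwards [ae_restrict_mem measurableSet_Ioi] with u hu
      exact (hd u hu).const_mul _
  rw [integral_mul_const, ← Real.Gamma_eq_integral hθ, mul_comm] at hlim
  refine hlim.congr' ?_
  filter_upwards [hl] with w hw
  have h := integral_comp_mul_left_Ioi
    (fun u => Real.exp (-u) * u ^ (θ - 1) * φ (u / w)) 0 hw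
  rw [mul_zero, smul_eq_mul, eq_inv_mul_iff_mul_eq₀ hw.ne'] at h
  rw [← h, ← integral_const_mul, ← integral_const_mul]
  refine setIntegral_congr_fun measurableSet_Ioi fun s hs => ?_
  have hs' : (0 : ℝ) < s := hs
  rw [mul_div_cancel_left₀ _ hw.ne', Real.mul_rpow hw.le hs'.le, Real.rpow_sub_one hw.ne']
  field_simp

theorem limit_of_renewal (hθ : 0 < θ) (hφm : Measurable φ) (hφ0 : ∀ t, 0 ≤ φ t)
    (hφ1 : ∀ t, φ t ≤ 1) (hgm : Measurable g) (hg0 : ∀ x, 0 ≤ g x) (hg1 : ∀ x, g x ≤ 1)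
    {a b : ℝ} (ha : 0 < a) (hgab : ∀ x, x ∉ Icc a b → g x = 1)
    (heq : ∀ t > 0, ENNReal.ofReal (t ^ θ * φ t) =
      ∫⁻ s in Ioo 0 t, ENNReal.ofReal (θ * (s ^ (θ - 1) * φ s)) * ENNReal.ofReal (g (t - s)))
    (h0 : Tendsto φ (𝓝[>] 0) (𝓝 1)) {c : ℝ} (hc : Tendsto φ atTop (𝓝 c)) :
    c = Real.exp (-∫ x in Icc a b, θ / x * (1 - g x)) := by
  -- the measures whose Laplace transforms enter the differential equation
  set ν := densityOn (fun t => t ^ (θ - 1) * φ t) (Ioi 0) with hν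
  set κ := densityOn (fun x => θ / x * (1 - g x)) (Icc a b) with hκ
  have hνm : Measurable fun t : ℝ => t ^ (θ - 1) * φ t := by fun_prop
  have hκm : Measurable fun x : ℝ => θ / x * (1 - g x) := by fun_prop
  have hν0 : ∀ t ∈ Ioi (0 : ℝ), 0 ≤ t ^ (θ - 1) * φ t := fun t ht =>
    mul_nonneg (Real.rpow_nonneg (le_of_lt ht) _) (hφ0 t)
  have hκ0 : ∀ x ∈ Icc a b, 0 ≤ θ / x * (1 - g x) := fun x hx =>
    mul_nonneg (div_nonneg hθ.le (ha.trans_le hx.1).le) (sub_nonneg.2 (hg1 x))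
  set M : ℝ → ℝ := fun w => ∫ s in Ioi 0, Real.exp (-(w * s)) * (s ^ (θ - 1) * φ s) with hM
  have hMmgf : ∀ w, mgf (fun t => -t) ν w = M w := by
    intro w
    rw [mgf, hν, integral_densityOn hνm measurableSet_Ioi hν0]
    refine integral_congr_ae (ae_of_all _ fun s => ?_)
    simp [mul_comm]
  have hMset : Ioi 0 ⊆ integrableExpSet (fun t => -t) ν := by
    intro w hw
    change Integrable _ _
    rw [hν, integrable_densityOn_iff hνm measurableSet_Ioi hν0]
    have := integrableOn_rpow_mul_exp_neg_mul_rpow (p := 1) (s := θ - 1) (b := w) (by linarith)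
      one_pos hw
    refine this.mono' (Measurable.aestronglyMeasurable (by fun_prop)) ?_
    filter_upwards [ae_restrict_mem measurableSet_Ioi] with s hs
    have hs' : (0 : ℝ) < s := hs
    have := hφ0 s
    rw [Real.norm_of_nonneg (by positivity), Real.rpow_one, mul_neg, neg_mul]
    gcongr
    exact mul_le_of_le_one_right (by positivity) (hφ1 s)
  have hMderiv : ∀ w > 0, HasDerivAt M
      (-(θ * M w * ∫ x in Ioi 0, Real.exp (-(w * x)) * g x)) w := by
    intro w hw
    -- Differentiating under the integral multiplies the integrand by `-s`, turning `s ^ (θ - 1)`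
    -- into `-s ^ θ`: minus the left side of the transformed renewal equation.
    have h1 := hasDerivAt_mgf (X := fun t => -t) (μ := ν) (t := w)
      (interior_maximal hMset isOpen_Ioi hw)
    have h2 : mgf (fun t => -t) ν = M := funext hMmgf
    rw [h2] at h1
    convert! h1 using 1
    rw [hν, integral_densityOn hνm measurableSet_Ioi hν0, ← integral_exp_renewal hφm hφ0 hgm hg0 hθ
      heq w, ← integral_neg]
    refine setIntegral_congr_fun measurableSet_Ioi fun s hs => ?_
    have hs' : (0 : ℝ) < s := hs
    rw [Real.rpow_sub_one hs'.ne', mul_neg]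
    field_simp
  set K : ℝ → ℝ := fun w => ∫ x in Icc a b, θ / x * (1 - g x) * Real.exp (-(w * x)) with hK
  have hKmgf : ∀ w, mgf (fun t => -t) κ w = K w := by
    intro w
    rw [mgf, hκ, integral_densityOn hκm measurableSet_Icc hκ0]
    simp [hK]
  have hbound : ∀ w : ℝ, ∀ x ∈ Icc a b, ‖θ / x * (1 - g x) * Real.exp (-(w * x))‖ ≤
      θ / a * 1 * Real.exp (-(w * x)) := by
    intro w x hx
    have := ha.trans_le hx.1
    rw [norm_mul, Real.norm_of_nonneg (hκ0 x hx), Real.norm_of_nonneg (Real.exp_pos _).le]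
    gcongr
    · exact sub_nonneg.2 (hg1 x)
    · exact hx.1
    · linarith [hg0 x]
  -- Finite everywhere, as `κ` lives on a compact interval away from `0`; in particular `K` is
  -- continuous at `0`, which the limit `w → 0+` needs.
  have hKset : integrableExpSet (fun t => -t) κ = univ := by
    refine eq_univ_of_forall fun w => ?_
    change Integrable _ _
    rw [hκ, integrable_densityOn_iff hκm measurableSet_Icc hκ0]
    have hcont : IntegrableOn (fun x : ℝ => θ / a * 1 * Real.exp (-(w * x))) (Icc a b) :=
      ContinuousOn.integrableOn_compact isCompact_Icc (by fun_prop)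
    refine Integrable.mono' hcont (Measurable.aestronglyMeasurable (by fun_prop)) ?_
    filter_upwards [ae_restrict_mem measurableSet_Icc] with x hx
    rw [mul_neg]
    exact hbound w x hx
  have hKderiv : ∀ w, HasDerivAt K
      (-(θ * ∫ x in Icc a b, Real.exp (-(w * x)) * (1 - g x))) w := by
    intro w
    have h1 := hasDerivAt_mgf (X := fun t => -t) (μ := κ) (t := w) (by simp [hKset])
    have h2 : mgf (fun t => -t) κ = K := funext hKmgf
    rw [h2] at h1
    convert! h1 using 1
    rw [hκ, integral_densityOn hκm measurableSet_Icc hκ0, ← integral_const_mul, ← integral_neg]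
    refine setIntegral_congr_fun measurableSet_Icc fun x hx => ?_
    have := (ha.trans_le hx.1).ne'
    rw [mul_neg]
    field_simp
  have hG : ∀ w > 0, (∫ x in Ioi 0, Real.exp (-(w * x)) * g x) =
      1 / w - ∫ x in Icc a b, Real.exp (-(w * x)) * (1 - g x) := by
    intro w hw
    have hexp : IntegrableOn (fun x : ℝ => Real.exp (-(w * x))) (Ioi 0) := by
      simpa [neg_mul] using integrableOn_exp_mul_Ioi (neg_lt_zero.2 hw) 0
    have hexpg : IntegrableOn (fun x : ℝ => Real.exp (-(w * x)) * g x) (Ioi 0) := by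
      refine Integrable.mono' hexp (Measurable.aestronglyMeasurable (by fun_prop))
        (ae_of_all _ fun x => ?_)
      rw [Real.norm_of_nonneg (mul_nonneg (Real.exp_pos _).le (hg0 x))]
      exact mul_le_of_le_one_right (Real.exp_pos _).le (hg1 x)
    have h1 : ∫ x in Ioi 0, Real.exp (-(w * x)) = 1 / w := by
      have := integral_exp_mul_Ioi (neg_lt_zero.2 hw) 0
      simpa [neg_mul] using this
    have h2 : ∫ x in Icc a b, Real.exp (-(w * x)) * (1 - g x) =
        ∫ x in Ioi 0, Real.exp (-(w * x)) * (1 - g x) := by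
      refine (setIntegral_eq_of_subset_of_forall_sdiff_eq_zero measurableSet_Ioi
        (fun x (hx : x ∈ Icc a b) => mem_Ioi.2 (ha.trans_le hx.1)) fun x hx => ?_).symm
      rw [hgab x hx.2, sub_self, mul_zero]
    rw [h2, ← h1, ← integral_sub hexp]
    · refine integral_congr_ae (ae_of_all _ fun x => ?_)
      dsimp only
      ring
    · simp_rw [mul_sub, mul_one]
      exact hexp.sub hexpg
  -- the conserved quantity
  set F : ℝ → ℝ := fun w => w ^ θ * M w * Real.exp (K w) with hF
  have hFderiv : ∀ w > 0, HasDerivAt F 0 w := by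
    intro w hw
    have h1 := ((Real.hasDerivAt_rpow_const (x := w) (p := θ) (Or.inl hw.ne')).mul
      (hMderiv w hw)).mul (hKderiv w).exp
    convert! h1 using 1
    rw [hG w hw, Real.rpow_sub_one hw.ne']
    simp only [Pi.mul_apply]
    field_simp
    ring
  have hFconst : ∀ w > 0, F w = F 1 := fun w hw =>
    isOpen_Ioi.is_const_of_deriv_eq_zero isPreconnected_Ioi
      (fun x hx => (hFderiv x hx).differentiableAt.differentiableWithinAt)
      (fun x hx => (hFderiv x hx).deriv) hw (mem_Ioi.2 one_pos)
  have hKtop : Tendsto K atTop (𝓝 0) := by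
    have : Tendsto K atTop (𝓝 (∫ x in Icc a b, (0 : ℝ))) := by
      refine tendsto_integral_filter_of_dominated_convergence (fun _ => θ / a)
        (Eventually.of_forall fun w => Measurable.aestronglyMeasurable (by fun_prop)) ?_
        (integrable_const _) ?_
      · filter_upwards [eventually_ge_atTop 0] with w hw
        filter_upwards [ae_restrict_mem measurableSet_Icc] with x hx
        refine (hbound w x hx).trans ?_
        rw [mul_one]
        refine mul_le_of_le_one_right (by positivity) (Real.exp_le_one_iff.2 ?_)
        have := ha.trans_le hx.1
        simp only [Left.neg_nonpos_iff]
        positivity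
      · filter_upwards [ae_restrict_mem measurableSet_Icc] with x hx
        have hx0 := ha.trans_le hx.1
        have : Tendsto (fun w => Real.exp (-(w * x))) atTop (𝓝 0) :=
          Real.tendsto_exp_neg_atTop_nhds_zero.comp (tendsto_id.atTop_mul_const hx0)
        simpa using this.const_mul (θ / x * (1 - g x))
    simpa using this
  -- Large `w` probes `φ` near `0`, and small `w` probes it near `∞`; comparing the two limits of
  -- the constant `F` yields `c`.
  have hFtop : Tendsto F atTop (𝓝 (1 * Real.Gamma θ * Real.exp 0)) := by
    refine (tendsto_rpow_mul_integral hθ hφm hφ0 hφ1 (eventually_gt_atTop 0)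
      fun u hu => ?_).mul ((Real.continuous_exp.tendsto 0).comp hKtop)
    refine h0.comp (tendsto_nhdsWithin_iff.2 ⟨tendsto_const_nhds.div_atTop tendsto_id, ?_⟩)
    filter_upwards [eventually_gt_atTop 0] with w hw
    exact mem_Ioi.2 (by positivity)
  have hFzero : Tendsto F (𝓝[>] 0) (𝓝 (c * Real.Gamma θ * Real.exp (K 0))) := by
    refine (tendsto_rpow_mul_integral hθ hφm hφ0 hφ1 self_mem_nhdsWithin fun u hu => ?_).mul
      ((Real.continuous_exp.tendsto _).comp
        ((hKderiv 0).continuousAt.tendsto.mono_left nhdsWithin_le_nhds))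
    refine hc.comp ?_
    exact tendsto_inv_nhdsGT_zero.const_mul_atTop hu
  have e1 : 1 * Real.Gamma θ * Real.exp 0 = F 1 := by
    refine tendsto_nhds_unique hFtop (tendsto_const_nhds.congr' ?_)
    filter_upwards [eventually_gt_atTop 0] with w hw
    exact (hFconst w hw).symm
  have e2 : c * Real.Gamma θ * Real.exp (K 0) = F 1 := by
    refine tendsto_nhds_unique hFzero (tendsto_const_nhds.congr' ?_)
    filter_upwards [self_mem_nhdsWithin] with w hw
    exact (hFconst w hw).symm
  have hΓ : Real.Gamma θ ≠ 0 := (Real.Gamma_pos_of_pos hθ).ne'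
  have e3 : c * Real.exp (K 0) = 1 := by
    refine mul_right_cancel₀ hΓ ?_
    rw [← e1, Real.exp_zero] at e2
    linarith
  have hK0 : K 0 = ∫ x in Icc a b, θ / x * (1 - g x) := by simp [hK]
  rw [Real.exp_neg, ← hK0]
  exact eq_inv_of_mul_eq_one_left e3

end RenewalEquation

/-! ### The Laplace functional of the spacings -/

lemma lintegral_pointProcess {Ω : Type*} (X : ℤ → Ω → ℝ) (ω : Ω) {f : ℝ → ℝ≥0∞}
    (hf : Measurable f) : ∫⁻ x, f x ∂(pointProcess X ω) = ∑' z, f (X z ω) := by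
  simp [pointProcess, lintegral_sum_measure, lintegral_dirac' _ hf]

lemma measurable_pointProcess {Ω : Type*} [MeasurableSpace Ω] {X : ℤ → Ω → ℝ}
    (hX : ∀ z, Measurable (X z)) : Measurable (pointProcess X) := by
  refine Measure.measurable_of_measurable_coe _ fun B hB => ?_
  simp only [pointProcess, Measure.sum_apply _ hB, Measure.dirac_apply' _ hB]
  exact Measurable.tsum fun z => (measurable_one.indicator hB).comp (hX z)

section Laplace

variable {Ω : Type*} [MeasurableSpace Ω] {T : ℤ → Ω → ℝ} {P : Measure Ω} {θ : ℝ} {f : ℝ → ℝ≥0∞}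

/-- The sum of `f` over the spacings of a sequence of points in decreasing order. -/
def spacingSum (f : ℝ → ℝ≥0∞) (x : ℕ → ℝ) : ℝ≥0∞ := ∑' k, f (x k - x (k + 1))

lemma measurable_spacingSum (hf : Measurable f) : Measurable (spacingSum f) :=
  Measurable.tsum fun k =>
    hf.comp ((measurable_pi_apply k).sub (measurable_pi_apply (k + 1)))

lemma spacingSum_eq_add (f : ℝ → ℝ≥0∞) (x : ℕ → ℝ) :
    spacingSum f x = f (x 0 - x 1) + spacingSum f fun k => x (k + 1) :=
  tsum_eq_zero_add' ENNReal.summable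

/-- The Laplace functional of the spacings between the points before `s` and an additional point
at `s`. -/
def pastLaplace (T : ℤ → Ω → ℝ) (P : Measure Ω) (f : ℝ → ℝ≥0∞) (s : ℝ) : ℝ≥0∞ :=
  ∫⁻ ω, expNeg (f (s - past T s ω 0) + spacingSum f (past T s ω)) ∂P

lemma measurable_expNeg_spacingSum (hf : Measurable f) :
    Measurable fun y : ℝ × (ℕ → ℝ) => expNeg (f (y.1 - y.2 0) + spacingSum f y.2) :=
  measurable_expNeg.comp ((hf.comp (measurable_fst.sub
    ((measurable_pi_apply 0).comp measurable_snd))).add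
      ((measurable_spacingSum hf).comp measurable_snd))

lemma measurable_pastLaplace (hT : IsRegularListing T) [IsProbabilityMeasure P]
    (hf : Measurable f) : Measurable (pastLaplace T P f) :=
  ((measurable_expNeg_spacingSum hf).comp hT.measurable_fst_past).lintegral_prod_right'

lemma pastLaplace_le_one [IsProbabilityMeasure P] (s : ℝ) : pastLaplace T P f s ≤ 1 := by
  refine (lintegral_mono fun ω => expNeg_le_one _).trans ?_
  simp

/-- The first spacing, from `t` to the last point `s`, splits off; by the renewal property the rest
is the same functional with the extra point at `s`. -/
lemma pastLaplace_eq (hT : IsRegularListing T) [IsProbabilityMeasure P] (hθ : 0 < θ)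
    (hPPP : IsScaleInvariantPPP T θ P) (hf : Measurable f) {t : ℝ} (ht : 0 < t) :
    pastLaplace T P f t = ∫⁻ s in Ioo 0 t, ENNReal.ofReal (θ / s) *
      (ENNReal.ofReal ((s / t) ^ θ) * (expNeg (f (t - s)) * pastLaplace T P f s)) := by
  have hH : Measurable fun y : ℝ × (ℕ → ℝ) =>
      expNeg (f (t - y.1)) * expNeg (f (y.1 - y.2 0) + spacingSum f y.2) :=
    (measurable_expNeg.comp (hf.comp (measurable_const.sub measurable_fst))).mul
      (measurable_expNeg_spacingSum hf)
  have h := lintegral_past_eq hT hθ hPPP ht hH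
  rw [pastLaplace]
  refine Eq.trans (lintegral_congr fun ω => ?_) (h.trans (lintegral_congr fun s => ?_))
  · rw [spacingSum_eq_add, expNeg_add]
  · dsimp only
    rw [lintegral_const_mul' _ _ (expNeg_ne_top _)]
    rfl

lemma spacingSum_past (hT : IsRegularListing T) {t : ℝ} (ht : 0 < t) (ω : Ω) :
    spacingSum f (past T t ω) = ∑' z, {z | T (z + 1) ω < t}.indicator
      (fun z => f (spacings T z ω)) z := by
  have hinj : Injective fun k : ℕ => lastIndex T t ω - (k + 1) := fun k l h => by
    simpa using h
  rw [← hinj.tsum_eq]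
  · refine tsum_congr fun k => ?_
    have hmem : lastIndex T t ω - ((k : ℤ) + 1) ∈ {z | T (z + 1) ω < t} := by
      rw [mem_ofPred_eq, hT.lt_iff ht]
      omega
    rw [indicator_of_mem hmem, past, past, spacings]
    congr 3
    ring
  · intro z hz
    have hz' : T (z + 1) ω < t := by
      by_contra hne
      have hmem : z ∉ {z | T (z + 1) ω < t} := hne
      exact hz (indicator_of_notMem hmem _)
    rw [hT.lt_iff ht] at hz'
    refine ⟨(lastIndex T t ω - (z + 1)).toNat, ?_⟩
    dsimp only
    omega

lemma tendsto_spacingSum_past (hT : IsRegularListing T) (ω : Ω) :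
    Tendsto (fun t => spacingSum f (past T t ω)) atTop (𝓝 (∑' z, f (spacings T z ω))) := by
  let G : ℝ → ℝ≥0∞ := fun t => ∑' z, {z | T (z + 1) ω < t}.indicator
    (fun z => f (spacings T z ω)) z
  have hmono : Monotone G := fun s t hst => ENNReal.tsum_le_tsum fun z =>
    indicator_le_indicator_of_subset (fun z (hz : _ < s) => lt_of_lt_of_le hz hst)
      (fun _ => zero_le) z
  have hlim := tendsto_atTop_iSup hmono
  have hsup : ⨆ t, G t = ∑' z, f (spacings T z ω) := by
    refine le_antisymm (iSup_le fun t => ENNReal.tsum_le_tsum fun z => indicator_le_self _ _ z) ?_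
    rw [ENNReal.tsum_eq_iSup_sum]
    refine iSup_le fun s => ?_
    obtain ⟨t, ht⟩ : ∃ t, ∀ z ∈ s, T (z + 1) ω < t := by
      obtain ⟨t, ht⟩ := (s.image fun z => T (z + 1) ω).bddAbove
      refine ⟨t + 1, fun z hz => ?_⟩
      have := ht (Finset.mem_coe.2 (Finset.mem_image_of_mem _ hz))
      linarith
    refine le_trans ?_ (le_iSup G t)
    refine le_trans (le_of_eq ?_) (ENNReal.sum_le_tsum s)
    refine Finset.sum_congr rfl fun z hz => ?_
    have hmem : z ∈ {z | T (z + 1) ω < t} := ht z hz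
    rw [indicator_of_mem hmem]
  rw [hsup] at hlim
  refine hlim.congr' ?_
  filter_upwards [eventually_gt_atTop 0] with t ht
  rw [spacingSum_past hT ht]

/-- The spacings before `t` exhaust all spacings as `t → ∞`. The artificial last spacing contributes
only if the last point is within `b` of `t`, an event whose probability vanishes because typical
gaps grow like `t`. -/
lemma tendsto_pastLaplace (hT : IsRegularListing T) [IsProbabilityMeasure P] (hθ : 0 < θ)
    (hPPP : IsScaleInvariantPPP T θ P) (hf : Measurable f) {b : ℝ} (hb : ∀ x, b < x → f x = 0) :
    Tendsto (pastLaplace T P f) atTop (𝓝 (∫⁻ ω, expNeg (∑' z, f (spacings T z ω)) ∂P)) := by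
  have hmS : ∀ t, Measurable fun ω => expNeg (spacingSum f (past T t ω)) := fun t =>
    measurable_expNeg.comp ((measurable_spacingSum hf).comp (hT.measurable_past_apply t))
  have hlim : Tendsto (fun t => ∫⁻ ω, expNeg (spacingSum f (past T t ω)) ∂P) atTop
      (𝓝 (∫⁻ ω, expNeg (∑' z, f (spacings T z ω)) ∂P)) := by
    refine tendsto_lintegral_filter_of_dominated_convergence (fun _ => 1)
      (Eventually.of_forall hmS)
      (Eventually.of_forall fun t => ae_of_all _ fun ω => expNeg_le_one _) (by simp)
      (ae_of_all _ fun ω => ?_)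
    exact (continuous_expNeg.tendsto _).comp (tendsto_spacingSum_past hT ω)
  have herr : Tendsto (fun t : ℝ => P {ω | t - b ≤ past T t ω 0}) atTop (𝓝 0) := by
    -- The sign of `b` is not known; `|b|` keeps the comparison point below `t`.
    have h1 : Tendsto (fun t : ℝ => ENNReal.ofReal (1 - ((t - |b|) / t) ^ θ)) atTop (𝓝 0) := by
      have h2 : Tendsto (fun t : ℝ => 1 - |b| * t⁻¹) atTop (𝓝 (1 - |b| * 0)) :=
        tendsto_const_nhds.sub (tendsto_inv_atTop_zero.const_mul _)
      rw [mul_zero, sub_zero] at h2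
      have h3 := ENNReal.tendsto_ofReal (tendsto_const_nhds (x := (1 : ℝ)) |>.sub
        (h2.rpow_const (p := θ) (Or.inl one_ne_zero)))
      rw [Real.one_rpow, sub_self, ENNReal.ofReal_zero] at h3
      refine h3.congr' ?_
      filter_upwards [eventually_gt_atTop 0] with t ht
      congr 3
      field_simp
    refine tendsto_of_tendsto_of_tendsto_of_le_of_le' tendsto_const_nhds h1
      (Eventually.of_forall fun _ => zero_le) ?_
    filter_upwards [eventually_gt_atTop |b|] with t ht
    have hsub : {ω | t - b ≤ past T t ω 0} ⊆ {ω | past T t ω 0 < t - |b|}ᶜ := by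
      intro ω (hω : t - b ≤ _)
      simp only [mem_compl_iff, mem_ofPred_eq, not_lt]
      linarith [le_abs_self b]
    refine (measure_mono hsub).trans (le_of_eq ?_)
    have hmeas : Measurable fun ω => past T t ω 0 :=
      (measurable_pi_apply 0).comp (hT.measurable_past_apply t)
    rw [← ofReal_measureReal,
      probReal_compl_eq_one_sub (measurableSet_lt hmeas measurable_const),
      hT.measureReal_past_zero_lt hθ hPPP (sub_pos.2 ht) (sub_le_self _ (abs_nonneg b))]
  have hlow : Tendsto (fun t => (∫⁻ ω, expNeg (spacingSum f (past T t ω)) ∂P) -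
      P {ω | t - b ≤ past T t ω 0}) atTop
      (𝓝 (∫⁻ ω, expNeg (∑' z, f (spacings T z ω)) ∂P)) := by
    have := ENNReal.Tendsto.sub hlim herr (Or.inr ENNReal.zero_ne_top)
    rwa [tsub_zero] at this
  refine tendsto_of_tendsto_of_tendsto_of_le_of_le hlow hlim (fun t => ?_) fun t =>
    lintegral_mono fun ω => expNeg_antitone le_add_self
  have hmeas : Measurable fun ω => past T t ω 0 :=
    (measurable_pi_apply 0).comp (hT.measurable_past_apply t)
  have hset : MeasurableSet {ω | t - b ≤ past T t ω 0} := measurableSet_le measurable_const hmeas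
  dsimp only
  rw [tsub_le_iff_right, pastLaplace, ← lintegral_indicator_one hset,
    ← lintegral_add_right _ (measurable_one.indicator hset)]
  refine lintegral_mono fun ω => ?_
  by_cases hω : ω ∈ {ω | t - b ≤ past T t ω 0}
  · rw [indicator_of_mem hω]
    exact (expNeg_le_one _).trans le_add_self
  · have : b < t - past T t ω 0 := by
      simp only [mem_ofPred_eq, not_le] at hω
      linarith
    rw [hb _ this, zero_add]
    exact le_self_add

/-- Points in `(0, t]` with `t < a` have all spacings below `a`, where `f` vanishes. This supplies
the initial value `φ(0+) = 1`. -/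
lemma pastLaplace_eq_one (hT : IsRegularListing T) [IsProbabilityMeasure P] {a : ℝ}
    (ha : ∀ x < a, f x = 0) {t : ℝ} (ht : 0 < t) (hta : t < a) : pastLaplace T P f t = 1 := by
  have h : ∀ ω, expNeg (f (t - past T t ω 0) + spacingSum f (past T t ω)) = 1 := by
    intro ω
    rw [ha _ (by linarith [hT.past_pos t ω 0]), zero_add, spacingSum]
    have h0 : ∀ k, f (past T t ω k - past T t ω (k + 1)) = 0 := fun k =>
      ha _ (by linarith [hT.past_pos t ω (k + 1), hT.past_lt ht ω k])
    simp [h0]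
  simp [pastLaplace, h]

theorem laplace_spacings_of_support (hT : IsRegularListing T) [IsProbabilityMeasure P]
    (hθ : 0 < θ) (hPPP : IsScaleInvariantPPP T θ P) (hf : Measurable f) {a b : ℝ} (ha : 0 < a)
    (hfab : ∀ x, x ∉ Icc a b → f x = 0) :
    ∫⁻ ω, expNeg (∫⁻ x, f x ∂(pointProcess (spacings T) ω)) ∂P =
      expNeg (∫⁻ x, (1 - expNeg (f x)) ∂scaleInvariantIntensity θ) := by
  simp_rw [lintegral_pointProcess _ _ hf]
  set c := ∫⁻ ω, expNeg (∑' z, f (spacings T z ω)) ∂P with hc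
  have hc1 : c ≤ 1 := (lintegral_mono fun ω => expNeg_le_one _).trans (by simp)
  have hc_top : c ≠ ∞ := ne_top_of_le_ne_top (by simp) hc1
  have hΦtop : ∀ s, pastLaplace T P f s ≠ ∞ := fun s =>
    ne_top_of_le_ne_top (by simp) (pastLaplace_le_one s)
  set φ : ℝ → ℝ := fun t => (pastLaplace T P f t).toReal
  set g : ℝ → ℝ := fun x => (expNeg (f x)).toReal with hg
  have hgm : Measurable g := (measurable_expNeg.comp hf).ennreal_toReal
  have hg1 : ∀ x, g x ≤ 1 := fun x =>
    ENNReal.toReal_le_of_le_ofReal zero_le_one (by simpa using expNeg_le_one _)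
  have hlim : c.toReal = Real.exp (-∫ x in Icc a b, θ / x * (1 - g x)) := by
    refine limit_of_renewal (φ := φ) hθ (measurable_pastLaplace hT hf).ennreal_toReal
      (fun t => ENNReal.toReal_nonneg)
      (fun t => ENNReal.toReal_le_of_le_ofReal zero_le_one (by simpa using pastLaplace_le_one _))
      hgm (fun x => ENNReal.toReal_nonneg) hg1 ha (fun x hx => by simp [hg, hfab x hx])
      (fun t ht => ?_) ?_ ?_
    · have ht' : (0 : ℝ) < t := ht
      rw [ENNReal.ofReal_mul (by positivity), ENNReal.ofReal_toReal (hΦtop t),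
        pastLaplace_eq hT hθ hPPP hf ht, ← lintegral_const_mul' _ _ ENNReal.ofReal_ne_top]
      refine setLIntegral_congr_fun measurableSet_Ioo fun s hs => ?_
      have hs' : 0 < s := hs.1
      have e : t ^ θ * (θ / s) * (s / t) ^ θ = θ * s ^ (θ - 1) := by
        rw [Real.div_rpow hs'.le ht'.le, Real.rpow_sub_one hs'.ne']
        have : t ^ θ ≠ 0 := (Real.rpow_pos_of_pos ht' _).ne'
        field_simp
      rw [← mul_assoc (ENNReal.ofReal (t ^ θ)), ← mul_assoc, ← ENNReal.ofReal_mul (by positivity),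
        ← ENNReal.ofReal_mul (by positivity), e, ← mul_assoc θ,
        ENNReal.ofReal_mul (p := θ * s ^ (θ - 1)) (by positivity),
        ENNReal.ofReal_toReal (hΦtop s), ENNReal.ofReal_toReal (expNeg_ne_top _)]
      ring
    · refine tendsto_const_nhds.congr' ?_
      filter_upwards [Ioo_mem_nhdsGT ha] with t ht
      rw [show φ t = (pastLaplace T P f t).toReal from rfl,
        pastLaplace_eq_one hT (fun x hx => hfab x fun h => hx.not_ge h.1) ht.1 ht.2]
      simp
    · exact (ENNReal.tendsto_toReal hc_top).comp
        (tendsto_pastLaplace hT hθ hPPP hf fun x hx => hfab x fun h => hx.not_ge h.2)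
  have hint : ∫⁻ x, (1 - expNeg (f x)) ∂scaleInvariantIntensity θ =
      ENNReal.ofReal (∫ x in Icc a b, θ / x * (1 - g x)) := by
    rw [lintegral_scaleInvariantIntensity θ (by fun_prop),
      ofReal_integral_eq_lintegral_ofReal]
    · rw [← lintegral_indicator measurableSet_Ioi, ← lintegral_indicator measurableSet_Icc]
      refine lintegral_congr fun x => ?_
      by_cases hx : x ∈ Icc a b
      · have hx0 : 0 < x := ha.trans_le hx.1
        rw [indicator_of_mem hx, indicator_of_mem (mem_Ioi.2 hx0),
          ENNReal.ofReal_mul (by positivity), ENNReal.ofReal_sub _ ENNReal.toReal_nonneg,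
          ENNReal.ofReal_toReal (expNeg_ne_top _), ENNReal.ofReal_one]
      · rw [indicator_of_notMem hx]
        by_cases hx0 : x ∈ Ioi 0 <;> simp [hx0, hfab x hx]
    · have hcont : IntegrableOn (fun x : ℝ => θ / x) (Icc a b) :=
        ContinuousOn.integrableOn_compact isCompact_Icc
          (continuousOn_const.div continuousOn_id fun x hx => (ha.trans_le hx.1).ne')
      refine Integrable.mono' hcont (Measurable.aestronglyMeasurable (by fun_prop)) ?_
      filter_upwards [ae_restrict_mem measurableSet_Icc] with x hx
      have hx0 : 0 < x := ha.trans_le hx.1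
      rw [Real.norm_of_nonneg (mul_nonneg (by positivity) (sub_nonneg.2 (hg1 x)))]
      exact mul_le_of_le_one_right (by positivity)
        (sub_le_self _ ENNReal.toReal_nonneg)
    · filter_upwards [ae_restrict_mem measurableSet_Icc] with x hx
      have hx0 : 0 < x := ha.trans_le hx.1
      exact mul_nonneg (by positivity) (sub_nonneg.2 (hg1 x))
  rw [hint, expNeg_ofReal, ← hlim, ENNReal.ofReal_toReal hc_top]
  refine setIntegral_nonneg measurableSet_Icc fun x hx => ?_
  exact mul_nonneg (div_nonneg hθ.le (ha.trans_le hx.1).le) (sub_nonneg.2 (hg1 x))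

theorem laplace_spacings (hT : IsRegularListing T) [IsProbabilityMeasure P]
    (hθ : 0 < θ) (hPPP : IsScaleInvariantPPP T θ P) (hf : Measurable f) :
    ∫⁻ ω, expNeg (∫⁻ x, f x ∂(pointProcess (spacings T) ω)) ∂P =
      expNeg (∫⁻ x, (1 - expNeg (f x)) ∂scaleInvariantIntensity θ) := by
  -- These intervals exhaust only `(0, ∞)`, so convergence of the integrals requires that neither
  -- the intensity nor the spacing process charge `(-∞, 0]`.
  let I : ℕ → Set ℝ := fun n => Icc (1 / (n + 1)) (n + 1)
  let F : ℕ → ℝ → ℝ≥0∞ := fun n => (I n).indicator f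
  have hF : ∀ n, Measurable (F n) := fun n => hf.indicator measurableSet_Icc
  have hI : Monotone I := fun m n hmn => by
    have : (m : ℝ) ≤ n := by exact_mod_cast hmn
    refine Icc_subset_Icc ?_ (by linarith)
    gcongr
  have hFmono : ∀ x, Monotone fun n => F n x := fun x m n hmn =>
    indicator_le_indicator_of_subset (hI hmn) (fun _ => zero_le) x
  have hFlim : ∀ x > 0, Tendsto (fun n => F n x) atTop (𝓝 (f x)) := by
    intro x hx
    refine tendsto_const_nhds.congr' ?_
    obtain ⟨m, hm⟩ := exists_nat_one_div_lt hx
    obtain ⟨n, hn⟩ := exists_nat_ge x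
    filter_upwards [eventually_ge_atTop (max m n)] with k hk
    have h1 : x ∈ I k := by
      refine hI hk ⟨?_, ?_⟩
      · refine le_trans ?_ hm.le
        have : (m : ℝ) ≤ (max m n : ℕ) := by exact_mod_cast le_max_left m n
        gcongr
      · have : (n : ℝ) ≤ (max m n : ℕ) := by exact_mod_cast le_max_right m n
        linarith
    exact (indicator_of_mem h1 f).symm
  have hlint : ∀ ρ : Measure ℝ, ρ (Iic 0) = 0 → ∀ Ψ : ℝ≥0∞ → ℝ≥0∞, Continuous Ψ → Monotone Ψ →
      Tendsto (fun n => ∫⁻ x, Ψ (F n x) ∂ρ) atTop (𝓝 (∫⁻ x, Ψ (f x) ∂ρ)) := by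
    intro ρ hρ Ψ hΨ hΨm
    refine lintegral_tendsto_of_tendsto_of_monotone
      (fun n => (hΨ.measurable.comp (hF n)).aemeasurable)
      (ae_of_all _ fun x => hΨm.comp (hFmono x)) ?_
    have : ∀ᵐ x ∂ρ, x ∉ Iic (0 : ℝ) := measure_eq_zero_iff_ae_notMem.1 hρ
    filter_upwards [this] with x hx
    exact (hΨ.tendsto _).comp (hFlim x (not_le.1 hx))
  have hleft : Tendsto (fun n => ∫⁻ ω, expNeg (∫⁻ x, F n x ∂(pointProcess (spacings T) ω)) ∂P) atTop
      (𝓝 (∫⁻ ω, expNeg (∫⁻ x, f x ∂(pointProcess (spacings T) ω)) ∂P)) := by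
    refine tendsto_lintegral_of_dominated_convergence (fun _ => 1) (fun n => ?_)
      (fun n => ae_of_all _ fun ω => expNeg_le_one _) (by simp) (ae_of_all _ fun ω => ?_)
    · refine measurable_expNeg.comp ((Measure.measurable_lintegral (hF n)).comp ?_)
      exact measurable_pointProcess fun z => (hT.measurable (z + 1)).sub (hT.measurable z)
    · refine (continuous_expNeg.tendsto _).comp (hlint _ ?_ id continuous_id monotone_id)
      rw [pointProcess_eq_zero_iff measurableSet_Iic]
      intro z
      simpa [spacings] using hT.strictMono ω (lt_add_one z)
  have hright : Tendsto (fun n => expNeg (∫⁻ x, (1 - expNeg (F n x)) ∂scaleInvariantIntensity θ))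
      atTop (𝓝 (expNeg (∫⁻ x, (1 - expNeg (f x)) ∂scaleInvariantIntensity θ))) := by
    refine (continuous_expNeg.tendsto _).comp (hlint _ (scaleInvariantIntensity_Iic θ)
      (fun y => 1 - expNeg y) ?_ fun x y hxy => tsub_le_tsub_left (expNeg_antitone hxy) _)
    exact (ENNReal.continuous_sub_left ENNReal.one_ne_top).comp continuous_expNeg
  refine tendsto_nhds_unique hleft (hright.congr fun n => ?_)
  exact (laplace_spacings_of_support hT hθ hPPP (hF n) (a := 1 / (n + 1)) (b := n + 1)
    (by positivity) fun x hx => indicator_of_notMem hx f).symm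

end Laplace

/-! ### Simplicity of scale invariant Poisson point processes -/

/-- Two coinciding points in the interval exclude the counts `0` and `1`. With `m` the intensity of
the interval, the remaining probability is `1 - e^(-m) (1 + m)`, at most `m ^ 2`. -/
lemma IsScaleInvariantPPP.measureReal_exists_eq_le {Ω : Type*} [MeasurableSpace Ω]
    {X : ℤ → Ω → ℝ} {P : Measure Ω} [IsProbabilityMeasure P] {θ : ℝ} (hθ : 0 < θ)
    (h : IsScaleInvariantPPP X θ P) {r s : ℝ} (hr : 0 < r) (hrs : r ≤ s) :
    P.real {ω | ∃ z w, z ≠ w ∧ X z ω = X w ω ∧ X z ω ∈ Ico r s} ≤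
      θ ^ 2 * (Real.log s - Real.log r) ^ 2 := by
  have hs := hr.trans_le hrs
  set m := θ * (Real.log s - Real.log r) with hm
  have hm0 : 0 ≤ m := mul_nonneg hθ.le (sub_nonneg.2 (Real.log_le_log hr hrs))
  set A : ℝ≥0∞ → Set Ω := fun k => {ω | pointProcess X ω (Ico r s) = k} with hA
  have hAm : ∀ k, NullMeasurableSet (A k) P := fun k =>
    (h.aemeasurable_apply measurableSet_Ico).nullMeasurable (measurableSet_singleton k)
  have hsub : {ω | ∃ z w, z ≠ w ∧ X z ω = X w ω ∧ X z ω ∈ Ico r s} ⊆ (A 0 ∪ A 1)ᶜ := by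
    rintro ω ⟨z, w, hzw, heq, hz⟩ (h0 | h1)
    · exact (pointProcess_eq_zero_iff measurableSet_Ico).1 h0 z hz
    · have h1' : pointProcess X ω (Ico r s) = 1 := h1
      rw [pointProcess_apply X ω measurableSet_Ico, ← ENat.toENNReal_one, ENat.toENNReal_inj,
        encard_eq_one] at h1'
      obtain ⟨v, hv⟩ := h1'
      have hzv : z ∈ ({v} : Set ℤ) := hv ▸ hz
      have hwv : w ∈ ({v} : Set ℤ) := hv ▸ (show X w ω ∈ Ico r s from heq ▸ hz)
      exact hzw (hzv.trans hwv.symm)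
  have hdisj : Disjoint (A 0) (A 1) := by
    refine Set.disjoint_left.2 fun ω h0 h1 => ?_
    have h0' : pointProcess X ω (Ico r s) = 0 := h0
    have h1' : pointProcess X ω (Ico r s) = 1 := h1
    exact zero_ne_one (h0'.symm.trans h1')
  have hexp : (r / s) ^ θ = Real.exp (-m) := by
    rw [Real.rpow_def_of_pos (by positivity), Real.log_div hr.ne' hs.ne', hm]
    congr 1
    ring
  have h0 : P.real (A 0) = Real.exp (-m) := by
    rw [Measure.real, IsScaleInvariantPPP.measure_Ico_eq_zero hθ h hr hrs, hexp,
      ENNReal.toReal_ofReal (Real.exp_pos _).le]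
  have h1 : P.real (A 1) = Real.exp (-m) * m := by
    rw [Measure.real, IsScaleInvariantPPP.measure_Ico_eq_one hθ h hr hrs, hexp,
      ENNReal.toReal_ofReal (mul_nonneg (Real.exp_pos _).le hm0)]
  refine (measureReal_mono hsub).trans ?_
  rw [probReal_compl_eq_one_sub₀ ((hAm 0).union (hAm 1)),
    measureReal_union₀ (hAm 1) hdisj.aedisjoint, h0, h1,
    show θ ^ 2 * (Real.log s - Real.log r) ^ 2 = m * m by rw [hm]; ring]
  nlinarith [Real.add_one_le_exp (-m)]

/-- The points of a scale invariant Poisson point process are almost surely distinct. -/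
theorem IsScaleInvariantPPP.ae_injective {Ω : Type*} [MeasurableSpace Ω]
    {X : ℤ → Ω → ℝ} (hX : ∀ z ω, 0 < X z ω) {P : Measure Ω} [IsProbabilityMeasure P] {θ : ℝ}
    (hθ : 0 < θ) (h : IsScaleInvariantPPP X θ P) : ∀ᵐ ω ∂P, Injective fun z => X z ω := by
  let D : ℝ → ℝ → Set Ω := fun u v =>
    {ω | ∃ z w, z ≠ w ∧ X z ω = X w ω ∧ X z ω ∈ Ico (Real.exp u) (Real.exp v)}
  have hzero : ∀ u v, P.real (D u v) = 0 := by
    intro u v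
    -- A coincidence has a single location, so extending the interval adds only coincidences in the
    -- new piece, of second-order probability.
    have hconst := eq_of_abs_sub_le_mul_sq (F := fun v => P.real (D u v)) (C := θ ^ 2)
      fun x y hxy => by
        have hsub : D u y ⊆ D u x ∪ D x y := by
          rintro ω ⟨z, w, hzw, heq, hz⟩
          rcases lt_or_ge (X z ω) (Real.exp x) with hlt | hge
          · exact Or.inl ⟨z, w, hzw, heq, hz.1, hlt⟩
          · exact Or.inr ⟨z, w, hzw, heq, hge, hz.2⟩
        have hmono : D u x ⊆ D u y := fun ω ⟨z, w, hzw, heq, hz⟩ =>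
          ⟨z, w, hzw, heq, hz.1, hz.2.trans_le (Real.exp_le_exp.2 hxy)⟩
        have h1 := (measureReal_mono (μ := P) hsub).trans (measureReal_union_le _ _)
        have h2 := h.measureReal_exists_eq_le hθ (Real.exp_pos x) (Real.exp_le_exp.2 hxy)
        rw [Real.log_exp, Real.log_exp] at h2
        rw [abs_of_nonneg (sub_nonneg.2 (measureReal_mono hmono))]
        have h3 : P.real (D x y) ≤ θ ^ 2 * (y - x) ^ 2 := h2
        linarith
    rw [hconst v u]
    have : D u u = ∅ := by
      refine eq_empty_of_forall_notMem ?_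
      rintro ω ⟨z, w, -, -, hz⟩
      exact hz.1.not_gt hz.2
    simp [this]
  have hae : ∀ᵐ ω ∂P, ∀ n : ℕ, ω ∉ D (-n) n := by
    rw [ae_all_iff]
    intro n
    have h0 := hzero (-n) n
    rw [measureReal_eq_zero_iff] at h0
    exact measure_eq_zero_iff_ae_notMem.1 h0
  filter_upwards [hae] with ω hω z w hzw
  by_contra hne
  obtain ⟨n, hn⟩ := exists_nat_gt |Real.log (X z ω)|
  refine hω n ⟨z, w, hne, hzw, ?_, ?_⟩
  · rw [← Real.le_log_iff_exp_le (hX z ω)]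
    exact (abs_lt.1 hn).1.le
  · rw [← Real.log_lt_iff_lt_exp (hX z ω)]
    exact (abs_lt.1 hn).2

end ScaleInvariantSpacings

end

/-! ### Transfer from the regular listing to the given one. -/

theorem theorem1p1 {Ω : Type*} [MeasurableSpace Ω] (P : Measure Ω) [IsProbabilityMeasure P]
    (θ : ℝ) (hθ : 0 < θ) (T : ℤ → Ω → ℝ) (hT : ∀ z, AEMeasurable (T z) P)
    (hmono : ∀ᵐ ω ∂P, ∀ z, T z ω < T (z + 1) ω)
    (hPPP : ScaleInvariantSpacings.IsScaleInvariantPPP T θ P) :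
    -- almost surely, the spacings are pairwise distinct: their point process is simple
    (∀ᵐ ω ∂P, Function.Injective fun z => ScaleInvariantSpacings.spacings T z ω) ∧
    -- the point processes of the spacings and of the points have the same distribution
    IdentDistrib (ScaleInvariantSpacings.pointProcess (ScaleInvariantSpacings.spacings T))
      (ScaleInvariantSpacings.pointProcess T) P P ∧
    -- the spacings form a scale invariant Poisson point process of the same rate
    ScaleInvariantSpacings.IsScaleInvariantPPP (ScaleInvariantSpacings.spacings T) θ P := by
  obtain ⟨T', hT', hTT'⟩ := ScaleInvariantSpacings.exists_isRegularListing hθ hT hmono hPPP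
  have hN : ScaleInvariantSpacings.pointProcess T =ᵐ[P] ScaleInvariantSpacings.pointProcess T' := by
    filter_upwards [hTT'] with ω hω
    simp [ScaleInvariantSpacings.pointProcess, hω]
  have hS : ∀ᵐ ω ∂P, ∀ z, ScaleInvariantSpacings.spacings T z ω =
      ScaleInvariantSpacings.spacings T' z ω := by
    filter_upwards [hTT'] with ω hω z
    simp [ScaleInvariantSpacings.spacings, hω]
  have hNS : ScaleInvariantSpacings.pointProcess (ScaleInvariantSpacings.spacings T') =ᵐ[P]
      ScaleInvariantSpacings.pointProcess (ScaleInvariantSpacings.spacings T) := by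
    filter_upwards [hS] with ω hω
    simp [ScaleInvariantSpacings.pointProcess, hω]
  have hPPP' : ScaleInvariantSpacings.IsScaleInvariantPPP T' θ P :=
    ScaleInvariantSpacings.IsPoissonPointProcess.congr hPPP hN
  have hmeas : ∀ z, Measurable (ScaleInvariantSpacings.spacings T' z) := fun z =>
    (hT'.measurable (z + 1)).sub (hT'.measurable z)
  have hspacings : ScaleInvariantSpacings.IsScaleInvariantPPP
      (ScaleInvariantSpacings.spacings T') θ P :=
    ScaleInvariantSpacings.IsPoissonPointProcess.of_laplace
      (ScaleInvariantSpacings.measurable_pointProcess hmeas).aemeasurable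
      fun f hf => ScaleInvariantSpacings.laplace_spacings hT' hθ hPPP' hf
  have hresult : ScaleInvariantSpacings.IsScaleInvariantPPP
      (ScaleInvariantSpacings.spacings T) θ P :=
    ScaleInvariantSpacings.IsPoissonPointProcess.congr hspacings hNS
  refine ⟨?_, ScaleInvariantSpacings.IsPoissonPointProcess.identDistrib hresult hPPP, hresult⟩
  have hpos : ∀ z ω, 0 < ScaleInvariantSpacings.spacings T' z ω := fun z ω =>
    sub_pos.2 (hT'.strictMono ω (lt_add_one z))
  filter_upwards [ScaleInvariantSpacings.IsScaleInvariantPPP.ae_injective hpos hθ hspacings, hS]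
    with ω hinj hω
  simpa only [hω] using hinj
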